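/- Let $k$ be a field and let $(H,R)$ be a finite dimensional quasi-triangular Hopf algebra over $k$, with comultiplication $\Delta(h)=\sum h_{(1)}\otimes h_{(2)}$, counit $\varepsilon$, antipode $S$ and R-matrix $R=\sum R^1\otimes R^2\in H\otimes H$ (that is, $R$ is invertible, $R\,\Delta(h)=\Delta^{cop}(h)\,R$ for all $h\in H$, $(\Delta\otimes \mathrm{id})(R)=R^{13}R^{23}$ and $(\mathrm{id}\otimes\Delta)(R)=R^{13}R^{12}$). Assume that $H$ is semisimple and cosemisimple. Write $h\cdot_{ad}a=\sum h_{(1)}\,a\,S(h_{(2)})$ for the left adjoint action, and let $H_R$ be the transmuted braided group of $(H,R)$: as a coalgebra it is the space $H$ with counit $\varepsilon$ and comultiplication $$\Delta_R(h)=\sum h_{(1)}S(R^2)\otimes R^1\cdot_{ad}h_{(2)} .$$ Let $D$ be a minimal $H$-adjoint-stable subcoalgebra of $H_R$, i.e. minimal among the nonzero subcoalgebras of $H_R$ that are stable under $\cdot_{ad}$. Let ${}^D_H\mathcal M$ be the category of left $H$-modules $V$ equipped with a left $D$-comodule structure $\rho(v)=\sum v^{\langle -1\rangle}\otimes v^{\langle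 0\rangle}$ such that $\rho(hv)=\sum h_{(1)}\cdot_{ad}v^{\langle -1\rangle}\otimes h_{(2)}v^{\langle 0\rangle}$ for all $h\in H$, $v\in V$. For a finite dimensional left $D$-comodule $W$, the dual $W^*$ is regarded as a right $D$-comodule by $\sum\langle f^{\langle 0\rangle},w\rangle f^{\langle 1\rangle}=\sum w^{\langle -1\rangle}\langle f,w^{\langle 0\rangle}\rangle$ for $f\in W^*$, $w\in W$, and $\square_D$ denotes the cotensor product over $D$. 1. If $W$ is a nonzero finite dimensional left $D$-comodule and $V\in{}^D_H\mathcal M$ is finite dimensional, then $$\dim(W^*\square_D V)\cdot\dim D=\dim V\cdot\dim W .$$ 2. In particular, for finite dimensional left $D$-comodules $W,W'$, let $N_{WW'}=W^*\square_D(H\otimes W')$, where $H\otimes W'$ has the left $D$-coaction $\rho(h\otimes w)=\sum h_{(1)}\cdot_{ad}w^{\langle -1\rangle}\otimes h_{(2)}\otimes w^{\langle 0\rangle}$. Then $$\dim N_{WW'}\cdot\dim D=\dim H\cdot\dim W\cdot\dim W' .$$ -/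

import Mathlib

open scoped TensorProduct

namespace Transmutation

noncomputable section

/-! ### Coalgebraic notions over a field

Coalgebra structures are given by their comultiplication `Δ` and counit `ε`, because two different
comultiplications on the same space are used below. -/

section Coalgebraic

variable {k : Type*} [Field k] {C : Type*} [AddCommGroup C] [Module k C]

/-- `D` is a subcoalgebra: `Δ(D) ⊆ D ⊗ D` inside `C ⊗ C`. -/
def IsSubcoalgebra (Δ : C →ₗ[k] C ⊗[k] C) (D : Submodule k C) : Prop :=
  ∀ x ∈ D, Δ x ∈ LinearMap.range (TensorProduct.map D.subtype D.subtype)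

/-- A simple subcoalgebra: a minimal nonzero subcoalgebra. -/
def IsSimpleSubcoalgebra (Δ : C →ₗ[k] C ⊗[k] C) (D : Submodule k C) : Prop :=
  Minimal (fun E : Submodule k C => E ≠ ⊥ ∧ IsSubcoalgebra Δ E) D

/-- A coalgebra is cosemisimple if it is the sum of its simple subcoalgebras. -/
def IsCosemisimple (Δ : C →ₗ[k] C ⊗[k] C) : Prop :=
  sSup {D : Submodule k C | IsSimpleSubcoalgebra Δ D} = ⊤

theorem map_subtype_injective (D : Submodule k C) :
    Function.Injective (TensorProduct.map D.subtype D.subtype) :=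
  TensorProduct.map_injective_of_flat_flat _ _ D.injective_subtype D.injective_subtype

/-- The restriction `D → D ⊗ D` of the comultiplication to a subcoalgebra `D`. -/
def restrictComul (Δ : C →ₗ[k] C ⊗[k] C) (D : Submodule k C) (hD : IsSubcoalgebra Δ D) :
    D →ₗ[k] D ⊗[k] D :=
  (LinearEquiv.ofInjective _ (map_subtype_injective D)).symm.toLinearMap ∘ₗ
    (Δ ∘ₗ D.subtype).codRestrict _ (fun x => hD x x.2)

theorem map_subtype_restrictComul (Δ : C →ₗ[k] C ⊗[k] C) (D : Submodule k C)
    (hD : IsSubcoalgebra Δ D) (x : D) :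
    TensorProduct.map D.subtype D.subtype (restrictComul Δ D hD x) = Δ x := by
  exact congrArg Subtype.val
    (LinearEquiv.apply_symm_apply (LinearEquiv.ofInjective _ (map_subtype_injective D))
      ((Δ ∘ₗ D.subtype).codRestrict _ (fun x => hD x x.2) x))

/-- A left comodule structure on `W` over the coalgebra `(C, Δ, ε)`. -/
structure LeftComodule (Δ : C →ₗ[k] C ⊗[k] C) (ε : C →ₗ[k] k)
    (W : Type*) [AddCommGroup W] [Module k W] where
  /-- The coaction `w ↦ ∑ w⟨-1⟩ ⊗ w⟨0⟩`. -/
  coact : W →ₗ[k] C ⊗[k] W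
  coassoc : (TensorProduct.assoc k C C W).toLinearMap ∘ₗ Δ.rTensor W ∘ₗ coact =
    coact.lTensor C ∘ₗ coact
  counit : (TensorProduct.lid k W).toLinearMap ∘ₗ ε.rTensor W ∘ₗ coact = LinearMap.id

/-- The right coaction on the dual of a finite dimensional left comodule `W`, determined by
`∑ ⟨f⟨0⟩, w⟩ f⟨1⟩ = ∑ w⟨-1⟩ ⟨f, w⟨0⟩⟩` for all `w`. -/
def dualCoact {W : Type*} [AddCommGroup W] [Module k W] [FiniteDimensional k W]
    (ρ : W →ₗ[k] C ⊗[k] W) : Module.Dual k W →ₗ[k] Module.Dual k W ⊗[k] C :=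
  (dualTensorHomEquiv k W C).symm.toLinearMap ∘ₗ
    LinearMap.lcomp k C ρ ∘ₗ
    LinearMap.llcomp k (C ⊗[k] W) (C ⊗[k] k) C (TensorProduct.rid k C).toLinearMap ∘ₗ
    LinearMap.lTensorHom C

theorem dualCoact_spec {W : Type*} [AddCommGroup W] [Module k W] [FiniteDimensional k W]
    (ρ : W →ₗ[k] C ⊗[k] W) (f : Module.Dual k W) (w : W) :
    dualTensorHom k W C (dualCoact ρ f) w = TensorProduct.rid k C (f.lTensor C (ρ w)) := by
  have h := LinearEquiv.apply_symm_apply (dualTensorHomEquiv k W C)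
    ((TensorProduct.rid k C).toLinearMap ∘ₗ f.lTensor C ∘ₗ ρ)
  exact LinearMap.congr_fun h w

/-- The cotensor product `M □ V`: the equalizer of `ρ ⊗ id` and `id ⊗ σ` in `M ⊗ V`, where `ρ` is
the right coaction of `M` and `σ` is the left coaction of `V`. -/
def cotensor {M V : Type*} [AddCommGroup M] [Module k M] [AddCommGroup V] [Module k V]
    (ρ : M →ₗ[k] M ⊗[k] C) (σ : V →ₗ[k] C ⊗[k] V) : Submodule k (M ⊗[k] V) :=
  LinearMap.eqLocus ((TensorProduct.assoc k M C V).toLinearMap ∘ₗ ρ.rTensor V) (σ.lTensor M)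

end Coalgebraic

/-! ### Quasi-triangular Hopf algebras and the transmuted comultiplication -/

section Hopf

variable {k : Type*} [Field k] {H : Type*} [Ring H] [HopfAlgebra k H]

/-- `R` is an R-matrix of `H`: it is invertible, `R Δ(h) = Δᶜᵒᵖ(h) R`, `(Δ ⊗ id) R = R¹³ R²³` and
`(id ⊗ Δ) R = R¹³ R¹²`. -/
structure IsRMatrix (R : H ⊗[k] H) : Prop where
  isUnit : IsUnit R
  mul_comul : ∀ h : H, R * Coalgebra.comul (R := k) h =
    TensorProduct.comm k H H (Coalgebra.comul (R := k) h) * R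
  comul_left :
    TensorProduct.assoc k H H H ((Coalgebra.comul (R := k) (A := H)).rTensor H R) =
      (TensorProduct.mk k H H 1).lTensor H R * ((1 : H) ⊗ₜ[k] R)
  comul_right :
    (Coalgebra.comul (R := k) (A := H)).lTensor H R =
      (TensorProduct.mk k H H 1).lTensor H R *
        TensorProduct.assoc k H H H (R ⊗ₜ[k] (1 : H))

variable (k H) in
/-- The left adjoint action `h ·ₐ a = ∑ h₍₁₎ a S(h₍₂₎)`. -/
def ad : H →ₗ[k] H →ₗ[k] H :=
  TensorProduct.lift
    ((LinearMap.mul k (Module.End k H)).compl₁₂ (LinearMap.mul k H)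
      ((LinearMap.mul k H).flip ∘ₗ HopfAlgebra.antipode k)) ∘ₗ
  Coalgebra.comul

theorem ad_apply {ι : Type*} (h a : H) (r : Coalgebra.Repr k h ι) :
    ad k H h a = ∑ i ∈ r.index, r.left i * a * HopfAlgebra.antipode k (r.right i) := by
  simp [ad, ← r.eq, mul_assoc]

/-- The linear map `R¹ ⊗ R² ↦ (a ⊗ b ↦ a S(R²) ⊗ R¹ ·ₐ b)`. -/
def twist : H ⊗[k] H →ₗ[k] H ⊗[k] H →ₗ[k] H ⊗[k] H :=
  TensorProduct.lift
    ((TensorProduct.mapBilinear (RingHom.id k) H H H H).compl₁₂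
      ((LinearMap.mul k H).flip ∘ₗ HopfAlgebra.antipode k) (ad k H)).flip

theorem twist_tmul (r s a b : H) :
    twist (r ⊗ₜ[k] s) (a ⊗ₜ[k] b) = (a * HopfAlgebra.antipode k s) ⊗ₜ[k] ad k H r b := by
  simp [twist]

/-- The comultiplication `Δ_R(h) = ∑ h₍₁₎ S(R²) ⊗ R¹ ·ₐ h₍₂₎` of the transmuted braided group
`H_R`. The counit of `H_R` is that of `H`. -/
def comulR (R : H ⊗[k] H) : H →ₗ[k] H ⊗[k] H := twist R ∘ₗ Coalgebra.comul

/-- An `H`-adjoint-stable subcoalgebra of `H_R`. -/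
structure AdStableSubcoalgebra (R : H ⊗[k] H) where
  /-- The underlying subspace of `H`. -/
  carrier : Submodule k H
  isSubcoalgebra : IsSubcoalgebra (comulR R) carrier
  ad_mem : ∀ h : H, ∀ a ∈ carrier, ad k H h a ∈ carrier

namespace AdStableSubcoalgebra

variable {R : H ⊗[k] H} (D : AdStableSubcoalgebra R)

/-- `D` is minimal among the nonzero `H`-adjoint-stable subcoalgebras of `H_R`. -/
def IsMinimal : Prop :=
  D.carrier ≠ ⊥ ∧ ∀ E : AdStableSubcoalgebra R,
    E.carrier ≠ ⊥ → E.carrier ≤ D.carrier → E.carrier = D.carrier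

/-- The comultiplication of `D`, restricted from `H_R`. -/
def comul : D.carrier →ₗ[k] D.carrier ⊗[k] D.carrier :=
  restrictComul (comulR R) D.carrier D.isSubcoalgebra

/-- The counit of `D`. -/
def counit : D.carrier →ₗ[k] k := Coalgebra.counit ∘ₗ D.carrier.subtype

/-- The adjoint action of `H` on `D`. -/
def adAction : H →ₗ[k] D.carrier →ₗ[k] D.carrier :=
  LinearMap.mk₂ k (fun h d => ⟨ad k H h d, D.ad_mem h d d.2⟩)
    (fun _ _ _ => Subtype.ext (by simp)) (fun _ _ _ => Subtype.ext (by simp))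
    (fun _ _ _ => Subtype.ext (by simp)) (fun _ _ _ => Subtype.ext (by simp))

/-- A left `D`-comodule structure on `W`. -/
abbrev Comodule (W : Type*) [AddCommGroup W] [Module k W] :=
  LeftComodule D.comul D.counit W

/-- An object of the category of `D`-comodules in the category of left `H`-modules: a left
`H`-module `V` with a left `D`-comodule structure such that
`ρ(h v) = ∑ h₍₁₎ ·ₐ v⟨-1⟩ ⊗ h₍₂₎ v⟨0⟩`. -/
structure ModuleComodule (V : Type*) [AddCommGroup V] [Module k V] [Module H V]
    [IsScalarTower k H V] extends LeftComodule D.comul D.counit V where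
  coact_smul : ∀ (h : H) (v : V), coact (h • v) =
    TensorProduct.map (TensorProduct.lift D.adAction)
      (TensorProduct.lift (Algebra.lsmul k k V).toLinearMap)
      (TensorProduct.tensorTensorTensorComm k H H D.carrier V
        (Coalgebra.comul (R := k) h ⊗ₜ[k] coact v))

/-- The left `D`-coaction `ρ(h ⊗ w) = ∑ h₍₁₎ ·ₐ w⟨-1⟩ ⊗ (h₍₂₎ ⊗ w⟨0⟩)` on `H ⊗ W`. -/
def inducedCoact {W : Type*} [AddCommGroup W] [Module k W] (ρ : D.Comodule W) :
    H ⊗[k] W →ₗ[k] D.carrier ⊗[k] (H ⊗[k] W) :=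
  (TensorProduct.lift D.adAction).rTensor (H ⊗[k] W) ∘ₗ
    (TensorProduct.tensorTensorTensorComm k H H D.carrier W).toLinearMap ∘ₗ
    TensorProduct.map Coalgebra.comul ρ.coact

/-- The cotensor product `W* □_D V`. -/
def dualCotensor {W : Type*} [AddCommGroup W] [Module k W] [FiniteDimensional k W]
    (ρ : D.Comodule W) {V : Type*} [AddCommGroup V] [Module k V]
    (σ : V →ₗ[k] D.carrier ⊗[k] V) : Submodule k (Module.Dual k W ⊗[k] V) :=
  cotensor (dualCoact ρ.coact) σ

/-- `N_{WW'} = W* □_D (H ⊗ W')`. -/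
def N {W : Type*} [AddCommGroup W] [Module k W] [FiniteDimensional k W] (ρ : D.Comodule W)
    {W' : Type*} [AddCommGroup W'] [Module k W'] (ρ' : D.Comodule W') :
    Submodule k (Module.Dual k W ⊗[k] (H ⊗[k] W')) :=
  D.dualCotensor ρ (D.inducedCoact ρ')

end AdStableSubcoalgebra

end Hopf

end

end Transmutation

/-! A coaction of a coalgebra C on W makes W a module over the free algebra `TensorAlgebra k (Dual k
C)`, with f acting by w ↦ ∑ f(w⟨-1⟩) w⟨0⟩. The linear maps over this algebra are exactly the maps
compatible with the coactions, so W* □ V has the dimension of Hom(W, V). Because the algebra is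
free, every coaction yields a module, and coassociativity of Δ_R is never needed. Composition with
the counit identifies Hom(X, C) with X* for every finite dimensional comodule X. Hence, as soon as
Vⁿ ≅ Cʳ with n > 0, both n · dim Hom(W, V) = r · dim W and n · dim V = r · dim C hold, and the
formula follows by eliminating n and r.

The heart is therefore `exists_pi_equiv_pi`. Choose a simple S ⊆ V with dim Hom(S, V) / dim S
maximal, and put n = dim S, r = dim Hom(S, V). By maximality no simple submodule of Vⁿ has more maps
to Vⁿ than to Cʳ, so the socle of Vⁿ embeds in Cʳ; functionals lift to maps into C, so the embedding
extends to an injective j : Vⁿ → Cʳ. For surjectivity, H ⊗ S carries a diagonal action for which dim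
Hom(H ⊗ S, Vⁿ) ≥ dim H · n · r, while dim Hom(H ⊗ S, Cʳ) ≤ r · dim H · n. Every map H ⊗ S → Cʳ thus
lands in the image of j. In each coordinate these maps reach all elements h · g(s) with g : S → C;
such elements span an H-stable subcoalgebra, which is C by minimality.

The Hopf algebraic input is that Δ_R commutes with the adjoint action (`comulR_ad`, from R Δ = Δᶜᵒᵖ
R) and that ε is a right counit for Δ_R (`evalRight_counit_comulR`). The second formula is the first
one for V = H ⊗ W'. -/

namespace Transmutation

open Module

/-! ### Dimensions of Hom spaces and embeddings of semisimple modules -/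

section HomDimension

variable {k A : Type*} [Field k] [Ring A] [Algebra k A]
  {M N : Type*} [AddCommGroup M] [Module k M] [Module A M] [IsScalarTower k A M]
  [AddCommGroup N] [Module k N] [Module A N] [IsScalarTower k A N]

instance finiteDimensional_hom [FiniteDimensional k M] [FiniteDimensional k N] :
    FiniteDimensional k (M →ₗ[A] N) :=
  FiniteDimensional.of_injective (LinearMap.restrictScalarsₗ k A M N k)
    (LinearMap.restrictScalars_injective k)

instance finiteDimensional_submodule [FiniteDimensional k M] (S : Submodule A M) :
    FiniteDimensional k S :=
  FiniteDimensional.of_injective (S.subtype.restrictScalars k) S.injective_subtype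

/-- Postcomposition with an `A`-linear map, as a `k`-linear map on spaces of `A`-linear maps. -/
def postcomp (X : Type*) [AddCommGroup X] [Module A X] (φ : M →ₗ[A] N) :
    (X →ₗ[A] M) →ₗ[k] (X →ₗ[A] N) where
  toFun f := φ ∘ₗ f
  map_add' f g := LinearMap.comp_add _ _ _
  map_smul' c f := by
    ext x
    exact (φ.restrictScalars k).map_smul c (f x)

theorem postcomp_injective (X : Type*) [AddCommGroup X] [Module A X] {φ : M →ₗ[A] N}
    (hφ : Function.Injective φ) : Function.Injective (postcomp (k := k) X φ) := fun f g h => by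
  ext x
  exact hφ (LinearMap.congr_fun h x)

theorem finrank_hom_pi (X : Type*) [AddCommGroup X] [Module k X] [Module A X] [IsScalarTower k A X]
    [FiniteDimensional k X] [FiniteDimensional k M] (n : ℕ) :
    finrank k (X →ₗ[A] (Fin n → M)) = n * finrank k (X →ₗ[A] M) := by
  let e : (X →ₗ[A] (Fin n → M)) ≃ₗ[k] (Fin n → (X →ₗ[A] M)) :=
    { toFun := fun f i => LinearMap.proj i ∘ₗ f
      invFun := LinearMap.pi
      map_add' := fun f g => rfl
      map_smul' := fun c f => rfl
      left_inv := fun f => rfl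
      right_inv := fun f => rfl }
  rw [e.finrank_eq, finrank_pi_fintype]
  simp

/-- A simple module with more maps to `N` than to a submodule `L` embedded in `N` yields an
embedded copy of itself meeting `L` trivially. -/
theorem exists_disjoint_range_of_finrank_hom_lt {S L : Type*} [AddCommGroup S] [Module k S]
    [Module A S] [IsScalarTower k A S] [AddCommGroup L] [Module k L] [Module A L]
    [IsScalarTower k A L] [FiniteDimensional k S] [FiniteDimensional k L] [FiniteDimensional k N]
    [IsSimpleModule A S] (φ : L →ₗ[A] N) (hφ : Function.Injective φ)
    (h : finrank k (S →ₗ[A] L) < finrank k (S →ₗ[A] N)) :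
    ∃ ψ : S →ₗ[A] N, Function.Injective ψ ∧ Disjoint (LinearMap.range φ) (LinearMap.range ψ) := by
  obtain ⟨ψ, hψ⟩ : ∃ ψ : S →ₗ[A] N, ψ ∉ LinearMap.range (postcomp (k := k) S φ) := by
    by_contra! H
    have h1 : LinearMap.range (postcomp (k := k) S φ) = ⊤ := by
      rw [eq_top_iff]; exact fun x _ => H x
    have h2 := LinearMap.finrank_range_le (postcomp (k := k) S φ)
    rw [h1, finrank_top] at h2
    omega
  have hψ0 : ψ ≠ 0 := by
    rintro rfl
    exact hψ (zero_mem _)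
  refine ⟨ψ, LinearMap.injective_of_ne_zero hψ0, ?_⟩
  -- Otherwise ψ would factor through the embedding φ, against its choice.
  have hle : ¬ LinearMap.range ψ ≤ LinearMap.range φ := by
    intro hle
    let e := LinearEquiv.ofInjective φ hφ
    refine hψ ⟨e.symm.toLinearMap ∘ₗ ψ.codRestrict _ (fun s => hle ⟨s, rfl⟩), ?_⟩
    ext s
    exact congrArg Subtype.val (e.apply_symm_apply ⟨ψ s, hle ⟨s, rfl⟩⟩)
  rcases eq_bot_or_eq_top ((LinearMap.range φ).comap ψ) with hb | ht
  · rw [Submodule.disjoint_def]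
    rintro _ hx ⟨s, rfl⟩
    have : s ∈ (LinearMap.range φ).comap ψ := hx
    rw [hb, Submodule.mem_bot] at this
    rw [this, map_zero]
  · refine absurd ?_ hle
    rintro _ ⟨s, rfl⟩
    have : s ∈ (LinearMap.range φ).comap ψ := ht ▸ Submodule.mem_top
    exact this

/-- Comparing dimensions of Hom spaces replaces comparing multiplicities, so the endomorphism rings
of the simple modules never enter. A largest submodule of `M` that embeds in `N` must be everything:
otherwise a simple module in a complement still has a spare map to `N`, and the embedding can be
enlarged. -/
theorem exists_injective_of_finrank_hom_le [FiniteDimensional k M] [FiniteDimensional k N]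
    [IsSemisimpleModule A M]
    (h : ∀ S : Submodule A M, IsSimpleModule A S →
      finrank k (S →ₗ[A] M) ≤ finrank k (S →ₗ[A] N)) :
    ∃ φ : M →ₗ[A] N, Function.Injective φ := by
  have : IsNoetherian A M := isNoetherian_of_tower k inferInstance
  obtain ⟨L, ⟨φ, hφ⟩, hmax⟩ := (wellFounded_gt (α := Submodule A M)).has_min
    {L | ∃ φ : L →ₗ[A] N, Function.Injective φ}
    ⟨⊥, 0, Function.injective_of_subsingleton _⟩
  by_cases hL : L = ⊤
  · subst hL
    exact ⟨φ ∘ₗ Submodule.topEquiv.symm.toLinearMap, hφ.comp Submodule.topEquiv.symm.injective⟩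
  exfalso
  obtain ⟨L', hL'⟩ := exists_isCompl L
  have hL'0 : L' ≠ ⊥ := by
    rintro rfl
    exact hL (by simpa using hL'.sup_eq_top)
  obtain ⟨S, hSL, hS⟩ := (IsSemisimpleModule.eq_bot_or_exists_simple_le L').resolve_left hL'0
  have hdis : Disjoint L S := hL'.disjoint.mono_right hSL
  -- The inclusion of `S` in `M` does not factor through `L`, so the inequality is strict.
  have hlt : finrank k (S →ₗ[A] L) < finrank k (S →ₗ[A] M) := by
    have hinj := postcomp_injective (k := k) S L.injective_subtype
    refine lt_of_le_of_ne (LinearMap.finrank_le_finrank_of_injective hinj) fun heq => ?_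
    obtain ⟨f, hf⟩ := (LinearMap.injective_iff_surjective_of_finrank_eq_finrank heq).1 hinj
      S.subtype
    have hSL' : S ≤ L := fun s hs => by
      have := LinearMap.congr_fun hf ⟨s, hs⟩
      exact (show (f ⟨s, hs⟩ : M) = s from this) ▸ (f ⟨s, hs⟩).2
    have : S = ⊥ := by simpa using hdis.symm.eq_bot_of_le hSL'
    exact (isSimpleModule_iff_isAtom.1 hS).1 this
  obtain ⟨ψ, hψ, hψφ⟩ := exists_disjoint_range_of_finrank_hom_lt φ hφ (hlt.trans_le (h S hS))
  let i : (L × S) →ₗ[A] M := L.subtype.coprod S.subtype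
  have hi : Function.Injective i := by
    rw [← LinearMap.ker_eq_bot, LinearMap.ker_coprod_of_disjoint_range _ _ (by simpa using hdis)]
    simp
  have hj : Function.Injective (φ.coprod ψ) := by
    rw [← LinearMap.ker_eq_bot, LinearMap.ker_coprod_of_disjoint_range _ _ hψφ,
      LinearMap.ker_eq_bot.2 hφ, LinearMap.ker_eq_bot.2 hψ]
    simp
  refine hmax (LinearMap.range i) ⟨φ.coprod ψ ∘ₗ (LinearEquiv.ofInjective i hi).symm.toLinearMap,
    hj.comp (LinearEquiv.ofInjective i hi).symm.injective⟩ ?_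
  have hrange : LinearMap.range i = L ⊔ S := by simp [i, LinearMap.range_coprod]
  rw [hrange]
  refine lt_of_le_of_ne le_sup_left fun heq => ?_
  have : S ≤ L := heq ▸ le_sup_right
  exact (isSimpleModule_iff_isAtom.1 hS).1 (by simpa using hdis.symm.eq_bot_of_le this)

/-- A nonzero finite dimensional module has a simple submodule `S` of greatest multiplicity
`dim Hom(S, V) / dim S`. -/
theorem exists_simple_max_ratio [FiniteDimensional k M] [Nontrivial M] :
    ∃ S : Submodule A M, IsSimpleModule A S ∧ ∀ S' : Submodule A M, IsSimpleModule A S' →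
      finrank k (S' →ₗ[A] M) * finrank k S ≤ finrank k (S →ₗ[A] M) * finrank k S' := by
  have : IsArtinian A M := isArtinian_of_tower k inferInstance
  let p : Submodule A M → ℕ × ℕ := fun S => (finrank k (S →ₗ[A] M), finrank k S)
  -- There may be infinitely many simple submodules, but the pairs of dimensions they produce are
  -- bounded, so a maximal ratio exists.
  have hfin : (p '' {S | IsSimpleModule A S}).Finite := by
    refine (Set.finite_Iic (finrank k (M →ₗ[k] M), finrank k M)).subset ?_
    rintro _ ⟨S, -, rfl⟩
    have hS : finrank k S ≤ finrank k M := Submodule.finrank_le (S.restrictScalars k)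
    refine ⟨?_, hS⟩
    calc finrank k (S →ₗ[A] M) ≤ finrank k (S →ₗ[k] M) :=
          LinearMap.finrank_le_finrank_of_injective
            (f := LinearMap.restrictScalarsₗ k A S M k) (LinearMap.restrictScalars_injective k)
      _ ≤ finrank k (M →ₗ[k] M) := by
          rw [finrank_linearMap, finrank_linearMap]
          exact Nat.mul_le_mul_right _ hS
  have hne : (p '' {S | IsSimpleModule A S}).Nonempty := by
    obtain ⟨S, hS, -⟩ := (eq_bot_or_exists_atom_le (⊤ : Submodule A M)).resolve_left top_ne_bot
    exact ⟨_, S, isSimpleModule_iff_isAtom.2 hS, rfl⟩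
  obtain ⟨_, ⟨S, hS, rfl⟩, hmax⟩ := Set.exists_max_image _ (fun q : ℕ × ℕ => (q.1 : ℚ) / q.2)
    hfin hne
  refine ⟨S, hS, fun S' hS' => ?_⟩
  have hpos : ∀ T : Submodule A M, IsSimpleModule A T → (0 : ℚ) < finrank k T := fun T hT => by
    have : Nontrivial T := IsSimpleModule.nontrivial A T
    exact_mod_cast (finrank_pos : 0 < finrank k T)
  have := hmax _ ⟨S', hS', rfl⟩
  simp only [p] at this
  rw [div_le_div_iff₀ (hpos S' hS') (hpos S hS)] at this
  exact_mod_cast this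

end HomDimension

/-! ### Sweedler sums as a calculus of multilinear functions -/

section Sweedler

variable (k : Type*) [Field k]

/-- A function of two variables that is linear in each of them. -/
structure IsBilin {M N Y : Type*} [AddCommGroup M] [Module k M] [AddCommGroup N] [Module k N]
    [AddCommGroup Y] [Module k Y] (B : M → N → Y) : Prop where
  add_left : ∀ x x' y, B (x + x') y = B x y + B x' y
  smul_left : ∀ (c : k) x y, B (c • x) y = c • B x y
  add_right : ∀ x y y', B x (y + y') = B x y + B x y'
  smul_right : ∀ (c : k) x y, B x (c • y) = c • B x y

/-- A function of three variables that is linear in each of them. -/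
structure IsTrilin {M N P Y : Type*} [AddCommGroup M] [Module k M] [AddCommGroup N] [Module k N]
    [AddCommGroup P] [Module k P] [AddCommGroup Y] [Module k Y] (B : M → N → P → Y) : Prop where
  left : ∀ z, IsBilin k (fun x y => B x y z)
  right : ∀ x, IsBilin k (fun y z => B x y z)

variable {k} {C Y Z : Type*} [AddCommGroup C] [Module k C] [Coalgebra k C]
  [AddCommGroup Y] [Module k Y] [AddCommGroup Z] [Module k Z]

/-- The bundled form of a bilinear function. -/
def IsBilin.toLinearMap {M N : Type*} [AddCommGroup M] [Module k M] [AddCommGroup N] [Module k N]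
    {B : M → N → Y} (hB : IsBilin k B) : M →ₗ[k] N →ₗ[k] Y :=
  LinearMap.mk₂ k B hB.add_left hB.smul_left hB.add_right hB.smul_right

variable (k) in
/-- The Sweedler sum `∑ B(h₍₁₎, h₍₂₎)`. -/
noncomputable def sweedler (B : C → C → Y) (h : C) : Y :=
  ∑ i ∈ (Coalgebra.Repr.arbitrary k h).index,
    B ((Coalgebra.Repr.arbitrary k h).left i) ((Coalgebra.Repr.arbitrary k h).right i)

theorem sweedler_eq_lift {B : C → C → Y} (hB : IsBilin k B) (h : C) :
    sweedler k B h = TensorProduct.lift hB.toLinearMap (Coalgebra.comul h) := by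
  conv_rhs => rw [← (Coalgebra.Repr.arbitrary k h).eq]
  simp [sweedler, IsBilin.toLinearMap]

theorem comul_eq_sweedler (h : C) :
    Coalgebra.comul h = sweedler k (fun x y => x ⊗ₜ[k] y) h :=
  (Coalgebra.Repr.arbitrary k h).eq.symm

omit [Module k Y] [Module k Z] in
theorem map_sweedler {F : Type*} [FunLike F Y Z] [AddMonoidHomClass F Y Z] (f : F)
    (B : C → C → Y) (h : C) :
    f (sweedler k B h) = sweedler k (fun x y => f (B x y)) h := by
  simp [sweedler]

omit [Module k Y] in
theorem sweedler_congr {B B' : C → C → Y} (hB : ∀ x y, B x y = B' x y) (h : C) :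
    sweedler k B h = sweedler k B' h := by
  simp [sweedler, hB]

omit [Module k Y] in
theorem sweedler_fun_add (B B' : C → C → Y) (h : C) :
    sweedler k (fun x y => B x y + B' x y) h = sweedler k B h + sweedler k B' h := by
  simp [sweedler, Finset.sum_add_distrib]

theorem sweedler_fun_smul (c : k) (B : C → C → Y) (h : C) :
    sweedler k (fun x y => c • B x y) h = c • sweedler k B h := by
  simp [sweedler, Finset.smul_sum]

theorem sweedler_add {B : C → C → Y} (hB : IsBilin k B) (h h' : C) :
    sweedler k B (h + h') = sweedler k B h + sweedler k B h' := by
  simp [sweedler_eq_lift hB]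

theorem sweedler_smul {B : C → C → Y} (hB : IsBilin k B) (c : k) (h : C) :
    sweedler k B (c • h) = c • sweedler k B h := by
  simp [sweedler_eq_lift hB]

/-- Coassociativity for an arbitrary trilinear expression: both sides are the values of one linear
map on C ⊗ (C ⊗ C). The computations with antipodes and coactions below rest on this reindexing. -/
theorem sweedler_coassoc {B : C → C → C → Y} (hB : IsTrilin k B) (h : C) :
    sweedler k (fun x y => sweedler k (fun u v => B u v y) x) h =
      sweedler k (fun x y => sweedler k (fun u v => B x u v) y) h := by
  let Θ : C ⊗[k] (C ⊗[k] C) →ₗ[k] Y := TensorProduct.lift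
    (LinearMap.mk₂ k (fun x t => TensorProduct.lift (hB.right x).toLinearMap t)
      (fun x x' t => by
        induction t with
        | zero => simp
        | add a b ha hb => simp only [map_add, ha, hb]; abel
        | tmul a b => simp [IsBilin.toLinearMap, (hB.left b).add_left])
      (fun c x t => by
        induction t with
        | zero => simp
        | add a b ha hb => simp only [map_add, ha, hb, smul_add]
        | tmul a b => simp [IsBilin.toLinearMap, (hB.left b).smul_left])
      (fun x t t' => by simp) (fun c x t => by simp))
  have hΘ : ∀ x y z, Θ (x ⊗ₜ (y ⊗ₜ z)) = B x y z := fun x y z => by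
    simp [Θ, IsBilin.toLinearMap]
  have := congrArg Θ (Coalgebra.sum_tmul_tmul_eq (Coalgebra.Repr.arbitrary k h)
    (fun i => Coalgebra.Repr.arbitrary k ((Coalgebra.Repr.arbitrary k h).left i))
    (fun i => Coalgebra.Repr.arbitrary k ((Coalgebra.Repr.arbitrary k h).right i)))
  simpa only [map_sum, hΘ, sweedler] using this

theorem sweedler_counit_left (f : C →ₗ[k] Y) (h : C) :
    sweedler k (fun x y => Coalgebra.counit (R := k) x • f y) h = f h := by
  have := Coalgebra.sum_counit_smul (Coalgebra.Repr.arbitrary k h)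
  conv_rhs => rw [← this]
  simp [sweedler]

theorem sweedler_counit_right (f : C →ₗ[k] Y) (h : C) :
    sweedler k (fun x y => Coalgebra.counit (R := k) y • f x) h = f h := by
  have := congrArg (TensorProduct.rid k Y) (Coalgebra.sum_map_tmul_counit_eq f h
    (repr := Coalgebra.Repr.arbitrary k h))
  simpa only [sweedler, map_sum, TensorProduct.rid_tmul, one_smul] using this

end Sweedler

/-! ### Sweedler sums in a Hopf algebra -/

section Hopf

variable {k H Y : Type*} [Field k] [Ring H] [HopfAlgebra k H] [AddCommGroup Y] [Module k Y]

theorem sweedler_antipode_mul (h : H) :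
    sweedler k (fun x y => HopfAlgebra.antipode k x * y) h = algebraMap k H (Coalgebra.counit h) :=
  HopfAlgebra.sum_antipode_mul_eq_algebraMap_counit _

theorem sweedler_mul {B : H → H → Y} (hB : IsBilin k B) (g h : H) :
    sweedler k B (g * h) =
      sweedler k (fun x y => sweedler k (fun u v => B (x * u) (y * v)) h) g := by
  rw [sweedler_eq_lift hB, Bialgebra.comul_mul, comul_eq_sweedler g, comul_eq_sweedler h]
  simp [sweedler, Finset.sum_mul_sum, IsBilin.toLinearMap]

theorem sweedler_one {B : H → H → Y} (hB : IsBilin k B) : sweedler k B 1 = B 1 1 := by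
  rw [sweedler_eq_lift hB, Bialgebra.comul_one, Algebra.TensorProduct.one_def]
  simp [IsBilin.toLinearMap]

end Hopf

/-! ### The induced module H ⊗ S and its maps -/

section Induced

variable {k H U : Type*} [Field k] [Ring H] [HopfAlgebra k H] [AddCommGroup U] [Module k U]

/-- The `H`-action on `Y` is compatible with the operators `U`:
`f (h y) = ∑ h₍₂₎ ((f ◁ h₍₁₎) y)`. -/
def IsCompatible (ψ : H →ₗ[k] U →ₗ[k] U) (Y : Type*) [AddCommGroup Y] [Module H Y]
    [Module (TensorAlgebra k U) Y] : Prop :=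
  ∀ (f : U) (h : H) (y : Y), TensorAlgebra.ι k f • h • y =
    sweedler k (fun u v => v • TensorAlgebra.ι k (ψ u f) • y) h

theorem IsCompatible.pi {ψ : H →ₗ[k] U →ₗ[k] U} {Y : Type*} [AddCommGroup Y] [Module H Y]
    [Module (TensorAlgebra k U) Y] (hY : IsCompatible ψ Y) (n : ℕ) :
    IsCompatible ψ (Fin n → Y) := fun f h y => by
  ext i
  simpa [sweedler] using hY f h (y i)

/-- Linear maps commuting with the generators of the tensor algebra are linear over it. -/
def linearMapOfι {X Y : Type*} [AddCommGroup X] [Module k X] [Module (TensorAlgebra k U) X]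
    [IsScalarTower k (TensorAlgebra k U) X] [AddCommGroup Y] [Module k Y]
    [Module (TensorAlgebra k U) Y] [IsScalarTower k (TensorAlgebra k U) Y] (g : X →ₗ[k] Y)
    (hg : ∀ (f : U) (x : X), g (TensorAlgebra.ι k f • x) = TensorAlgebra.ι k f • g x) :
    X →ₗ[TensorAlgebra k U] Y where
  toFun := g
  map_add' := g.map_add
  map_smul' a x := by
    simp only [RingHom.id_apply]
    induction a using TensorAlgebra.induction generalizing x with
    | algebraMap r => simp [algebraMap_smul]
    | ι f => exact hg f x
    | mul a b ha hb => rw [mul_smul, ha, hb, mul_smul]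
    | add a b ha hb => rw [add_smul, map_add, ha, hb, add_smul]

/-- The module `H ⊗ S` on which `f` acts by `h ⊗ s ↦ ∑ h₍₂₎ ⊗ (f ◁ h₍₁₎) s`. -/
def Induced (_ψ : H →ₗ[k] U →ₗ[k] U) (S : Type*) [AddCommGroup S] [Module k S] : Type _ :=
  H ⊗[k] S

namespace Induced

variable (ψ : H →ₗ[k] U →ₗ[k] U) (S : Type*) [AddCommGroup S] [Module k S]

noncomputable instance : AddCommGroup (Induced ψ S) := inferInstanceAs (AddCommGroup (H ⊗[k] S))

noncomputable instance : Module k (Induced ψ S) := inferInstanceAs (Module k (H ⊗[k] S))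

instance [FiniteDimensional k H] [FiniteDimensional k S] : FiniteDimensional k (Induced ψ S) :=
  inferInstanceAs (FiniteDimensional k (H ⊗[k] S))

theorem finrank_eq : finrank k (Induced ψ S) = finrank k H * finrank k S :=
  finrank_tensorProduct

variable [Module (TensorAlgebra k U) S] [IsScalarTower k (TensorAlgebra k U) S]

theorem isBilin_act (f : U) (s : S) : IsBilin k
    (fun u v : H => v ⊗ₜ[k] (TensorAlgebra.ι k (ψ u f) • s)) where
  add_left _ _ _ := by simp [add_smul, TensorProduct.tmul_add]
  smul_left _ _ _ := by simp
  add_right _ _ _ := by simp [TensorProduct.add_tmul]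
  smul_right _ _ _ := by simp [TensorProduct.smul_tmul']

/-- The action of the generators on the induced module. -/
noncomputable def act : U →ₗ[k] H ⊗[k] S →ₗ[k] H ⊗[k] S :=
  LinearMap.mk₂ k (fun f t => TensorProduct.lift
      (LinearMap.mk₂ k (fun h s => sweedler k (fun u v => v ⊗ₜ (TensorAlgebra.ι k (ψ u f) • s)) h)
        (fun _ _ s => sweedler_add (isBilin_act ψ S f s) _ _)
        (fun _ _ s => sweedler_smul (isBilin_act ψ S f s) _ _)
        (fun h s s' => by simp [TensorProduct.tmul_add, sweedler_fun_add])
        (fun c h s => by simp [smul_comm _ c, sweedler_fun_smul])) t)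
    (fun f f' t => by
      induction t with
      | zero => simp
      | add a b ha hb => rw [map_add, map_add, map_add, ha, hb]; abel
      | tmul h s => simp [add_smul, TensorProduct.tmul_add, sweedler_fun_add])
    (fun c f t => by
      induction t with
      | zero => simp
      | add a b ha hb => rw [map_add, map_add, ha, hb, smul_add]
      | tmul h s => simp [sweedler_fun_smul])
    (fun f t t' => by simp) (fun c f t => by simp)

/-- The action of the generators, as endomorphisms of the induced module. -/
noncomputable def actEnd : U →ₗ[k] Module.End k (Induced ψ S) := act ψ S

noncomputable instance : Module (TensorAlgebra k U) (Induced ψ S) :=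
  Module.compHom _ (TensorAlgebra.lift k (actEnd ψ S)).toRingHom

theorem smul_def (a : TensorAlgebra k U) (x : Induced ψ S) :
    a • x = TensorAlgebra.lift k (actEnd ψ S) a x := rfl

variable {S} in
theorem ι_smul (f : U) (x : Induced ψ S) : TensorAlgebra.ι k f • x = actEnd ψ S f x := by
  have h : TensorAlgebra.lift k (actEnd ψ S) (TensorAlgebra.ι k f) = actEnd ψ S f :=
    TensorAlgebra.lift_ι_apply _ _
  rw [smul_def, h]

instance : IsScalarTower k (TensorAlgebra k U) (Induced ψ S) :=
  ⟨fun c a x => by simp [smul_def]⟩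

variable {S}

/-- The element `h ⊗ s` of the induced module. -/
def tmul (h : H) (s : S) : Induced ψ S := h ⊗ₜ[k] s

omit [Module (TensorAlgebra k U) S] [IsScalarTower k (TensorAlgebra k U) S] in
@[elab_as_elim]
theorem induction_on {p : Induced ψ S → Prop} (x : Induced ψ S) (zero : p 0)
    (tmul : ∀ h s, p (tmul ψ h s)) (add : ∀ x y, p x → p y → p (x + y)) : p x :=
  TensorProduct.induction_on x zero tmul add

theorem ι_smul_tmul (f : U) (h : H) (s : S) :
    TensorAlgebra.ι k f • tmul ψ h s =
      sweedler k (fun u v => tmul ψ v (TensorAlgebra.ι k (ψ u f) • s)) h := by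
  rw [ι_smul]
  have : act ψ S f (h ⊗ₜ s) = sweedler k (fun u v => v ⊗ₜ (TensorAlgebra.ι k (ψ u f) • s)) h :=
    TensorProduct.lift.tmul _ _
  exact this

variable {ψ} {Y : Type*} [AddCommGroup Y] [Module k Y] [Module H Y] [IsScalarTower k H Y]
  [Module (TensorAlgebra k U) Y] [IsScalarTower k (TensorAlgebra k U) Y]

omit [Module k S] [IsScalarTower k (TensorAlgebra k U) S] in
theorem isBilin_lift (g : H →ₗ[k] (S →ₗ[TensorAlgebra k U] Y)) (s : S) :
    IsBilin k (fun u v : H => u • g v s) where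
  add_left _ _ _ := by simp [add_smul]
  smul_left _ _ _ := by simp
  add_right _ _ _ := by simp [smul_add]
  smul_right c u v := by simp [smul_comm u c]

/-- The `k`-linear map `h ⊗ s ↦ ∑ h₍₁₎ g(h₍₂₎)(s)`. -/
noncomputable def liftₗ (g : H →ₗ[k] (S →ₗ[TensorAlgebra k U] Y)) : Induced ψ S →ₗ[k] Y :=
  TensorProduct.lift (LinearMap.mk₂ k (fun h s => sweedler k (fun u v => u • g v s) h)
    (fun _ _ s => sweedler_add (isBilin_lift g s) _ _)
    (fun _ _ s => sweedler_smul (isBilin_lift g s) _ _)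
    (fun h s s' => by simp [smul_add, sweedler_fun_add])
    (fun c h s => by simp [smul_comm _ c, sweedler_fun_smul]))

theorem liftₗ_tmul (g : H →ₗ[k] (S →ₗ[TensorAlgebra k U] Y)) (h : H) (s : S) :
    liftₗ g (tmul ψ h s) = sweedler k (fun u v => u • g v s) h :=
  TensorProduct.lift.tmul _ _

theorem liftₗ_ι_smul (hY : IsCompatible ψ Y) (g : H →ₗ[k] (S →ₗ[TensorAlgebra k U] Y)) (f : U)
    (x : Induced ψ S) :
    liftₗ g (TensorAlgebra.ι k f • x) = TensorAlgebra.ι k f • liftₗ g x := by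
  induction x using Induced.induction_on with
  | zero => simp
  | add a b ha hb => rw [smul_add, map_add, ha, hb, ← smul_add, map_add]
  | tmul h s =>
    -- Both sides equal ∑ h₍₂₎ (f ◁ h₍₁₎) g(h₍₃₎)(s): one by the action on the induced module, the
    -- other by compatibility of `Y`.
    have htri : IsTrilin k (fun u v w : H => v • TensorAlgebra.ι k (ψ u f) • g w s) :=
      ⟨fun z => ⟨by simp [add_smul], fun c x y => by simp [smul_comm y c], by simp [add_smul],
        by simp⟩,
       fun z => ⟨by simp [add_smul], by simp, by simp, fun c x y => by
        simp [smul_comm x c, smul_comm _ c (g y s)]⟩⟩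
    rw [ι_smul_tmul, map_sweedler, liftₗ_tmul]
    simp only [liftₗ_tmul, map_smul]
    rw [← sweedler_coassoc htri]
    simp only [← hY f]
    simp [sweedler, Finset.smul_sum]

/-- Since ∑ S(h₍₁₎) h₍₂₎ = ε(h), the antipode undoes the twist in `liftₗ` and recovers `g`. This is
what makes `liftHom` injective. -/
theorem antipode_liftₗ (g : H →ₗ[k] (S →ₗ[TensorAlgebra k U] Y)) (h : H) (s : S) :
    sweedler k (fun u v => HopfAlgebra.antipode k u • liftₗ g (tmul ψ v s)) h = g h s := by
  have htri : IsTrilin k (fun u v w : H => HopfAlgebra.antipode k u • v • g w s) :=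
    ⟨fun z => ⟨by simp [add_smul], by simp, by simp [add_smul],
      fun c x y => by simp [smul_comm _ c (y • g z s)]⟩,
     fun z => ⟨by simp [add_smul], fun c x y => by simp [smul_comm _ c (x • g y s)], by simp,
      fun c x y => by simp [smul_comm _ c (g y s), smul_comm _ c (x • g y s)]⟩⟩
  simp only [liftₗ_tmul]
  have h1 : sweedler k (fun u v => HopfAlgebra.antipode k u •
      sweedler k (fun a b => a • g b s) v) h =
      sweedler k (fun u v => sweedler k (fun a b => HopfAlgebra.antipode k u • a • g b s) v) h := by
    simp [sweedler, Finset.smul_sum]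
  rw [h1, ← sweedler_coassoc htri]
  have h2 : ∀ u v : H, sweedler k (fun a b => HopfAlgebra.antipode k a • b • g v s) u =
      Coalgebra.counit (R := k) u • g v s := fun u v => by
    have := congrArg (fun z : H => z • g v s) (sweedler_antipode_mul (k := k) u)
    simpa [sweedler, Finset.sum_smul, mul_smul] using this
  simp only [h2]
  exact sweedler_counit_left ((LinearMap.applyₗ s).comp
    ((LinearMap.restrictScalarsₗ k (TensorAlgebra k U) S Y k).comp g)) h

variable (ψ S Y) in
/-- Every linear map `H → Hom(S, Y)` induces a map of modules `H ⊗ S → Y`. -/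
noncomputable def liftHom (hY : IsCompatible ψ Y) : (H →ₗ[k] (S →ₗ[TensorAlgebra k U] Y)) →ₗ[k]
    (Induced ψ S →ₗ[TensorAlgebra k U] Y) where
  toFun g := linearMapOfι (liftₗ g) (liftₗ_ι_smul hY g)
  map_add' g g' := by
    ext x
    change liftₗ (g + g') x = liftₗ g x + liftₗ g' x
    rw [← LinearMap.add_apply]
    congr 1
    exact TensorProduct.ext' fun h s => by
      change liftₗ (g + g') (tmul ψ h s) = liftₗ g (tmul ψ h s) + liftₗ g' (tmul ψ h s)
      simp [liftₗ_tmul, sweedler_fun_add]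
  map_smul' c g := by
    ext x
    change liftₗ (c • g) x = c • liftₗ g x
    rw [← LinearMap.smul_apply]
    congr 1
    exact TensorProduct.ext' fun h s => by
      change liftₗ (c • g) (tmul ψ h s) = c • liftₗ g (tmul ψ h s)
      simp [liftₗ_tmul, smul_comm _ c, sweedler_fun_smul]

theorem liftHom_tmul (hY : IsCompatible ψ Y) (g : H →ₗ[k] (S →ₗ[TensorAlgebra k U] Y)) (h : H)
    (s : S) : liftHom ψ S Y hY g (tmul ψ h s) = sweedler k (fun u v => u • g v s) h :=
  liftₗ_tmul (ψ := ψ) g h s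

theorem liftHom_injective (hY : IsCompatible ψ Y) : Function.Injective (liftHom ψ S Y hY) := by
  rw [injective_iff_map_eq_zero]
  intro g hg
  ext h s
  rw [← antipode_liftₗ (ψ := ψ) g h s]
  have : ∀ v : H, liftₗ g (tmul ψ v s) = 0 := fun v => LinearMap.congr_fun hg (tmul ψ v s)
  simp [this, sweedler]

/-- This lower bound, taken for powers of V, is played against the upper bound
`Separates.finrank_hom_le` for maps into C. -/
theorem finrank_mul_finrank_hom_le [FiniteDimensional k H] [FiniteDimensional k S]
    [FiniteDimensional k Y] (hY : IsCompatible ψ Y) :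
    finrank k H * finrank k (S →ₗ[TensorAlgebra k U] Y) ≤
      finrank k (Induced ψ S →ₗ[TensorAlgebra k U] Y) := by
  rw [← finrank_linearMap (R := k) (S := k)]
  exact LinearMap.finrank_le_finrank_of_injective (liftHom_injective hY)

end Induced

end Induced

/-! ### Modules cogenerated by a counit -/

section Cofree

variable {k A : Type*} [Field k] [Ring A] [Algebra k A]
  {C X Y : Type*} [AddCommGroup C] [Module k C] [Module A C] [IsScalarTower k A C]
  [AddCommGroup X] [Module k X] [Module A X] [IsScalarTower k A X]
  [AddCommGroup Y] [Module k Y] [Module A Y] [IsScalarTower k A Y]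

variable (A) in
/-- No nonzero element of `C` generates a submodule in the kernel of `ε`. -/
def Separates (ε : C →ₗ[k] k) : Prop :=
  ∀ c : C, (∀ a : A, ε (a • c) = 0) → c = 0

variable (A) in
/-- Every functional on `X` is the composition of `ε` with an `A`-linear map `X → C`. -/
def LiftsFunctionals (ε : C →ₗ[k] k) (X : Type*) [AddCommGroup X] [Module k X] [Module A X] :
    Prop :=
  ∀ f : X →ₗ[k] k, ∃ g : X →ₗ[A] C, ∀ x, ε (g x) = f x

variable {ε : C →ₗ[k] k}

omit [Algebra k A] [IsScalarTower k A C] in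
theorem Separates.hom_ext (hε : Separates A ε) {X : Type*} [AddCommGroup X] [Module A X]
    {g g' : X →ₗ[A] C} (h : ∀ x, ε (g x) = ε (g' x)) : g = g' := by
  ext x
  rw [← sub_eq_zero]
  refine hε _ fun a => ?_
  rw [smul_sub, map_sub, ← map_smul, ← map_smul, h, sub_self]

variable (ε X) in
/-- Composition with `ε`. -/
def counitComp : (X →ₗ[A] C) →ₗ[k] (X →ₗ[k] k) where
  toFun g := ε ∘ₗ g.restrictScalars k
  map_add' g g' := by ext; simp
  map_smul' c g := by ext; simp

theorem Separates.counitComp_injective (hε : Separates A ε) :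
    Function.Injective (counitComp (A := A) X ε) :=
  fun _ _ h => hε.hom_ext (LinearMap.congr_fun h)

theorem Separates.finrank_hom_le (hε : Separates A ε) [FiniteDimensional k X]
    [FiniteDimensional k C] : finrank k (X →ₗ[A] C) ≤ finrank k X :=
  (LinearMap.finrank_le_finrank_of_injective hε.counitComp_injective).trans
    (by rw [finrank_linearMap, finrank_self, mul_one])

/-- Separation makes composition with ε injective, and lifting of functionals makes it surjective,
so Hom(X, C) ≅ X*. -/
theorem Separates.finrank_hom_eq (hε : Separates A ε) [FiniteDimensional k X]
    [FiniteDimensional k C] (hX : LiftsFunctionals A ε X) :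
    finrank k (X →ₗ[A] C) = finrank k X := by
  rw [(LinearEquiv.ofBijective (counitComp (A := A) X ε) ⟨hε.counitComp_injective, fun f => by
    obtain ⟨g, hg⟩ := hX f
    exact ⟨g, LinearMap.ext hg⟩⟩).finrank_eq, finrank_linearMap, finrank_self, mul_one]

omit [IsScalarTower k A C] in
theorem LiftsFunctionals.of_injective (hY : LiftsFunctionals A ε Y) (i : X →ₗ[A] Y)
    (hi : Function.Injective i) : LiftsFunctionals A ε X := fun f => by
  obtain ⟨p, hp⟩ := LinearMap.exists_leftInverse_of_injective (i.restrictScalars k)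
    (LinearMap.ker_eq_bot.2 hi)
  obtain ⟨g, hg⟩ := hY (f ∘ₗ p)
  refine ⟨g ∘ₗ i, fun x => ?_⟩
  have : p (i x) = x := LinearMap.congr_fun hp x
  simp [hg, this]

omit [Algebra k A] [IsScalarTower k A C] [IsScalarTower k A Y] in
theorem LiftsFunctionals.pi (hY : LiftsFunctionals A ε Y) (n : ℕ) :
    LiftsFunctionals A ε (Fin n → Y) := fun f => by
  choose g hg using fun i => hY (f ∘ₗ LinearMap.single k (fun _ => Y) i)
  refine ⟨∑ i, g i ∘ₗ LinearMap.proj i, fun x => ?_⟩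
  conv_rhs => rw [← Finset.univ_sum_single x]
  simp [hg]

omit [Module k X] [IsScalarTower k A X] in
theorem finrank_hom_congr_left {X' : Type*} [AddCommGroup X'] [Module A X']
    (e : X ≃ₗ[A] X') : finrank k (X →ₗ[A] Y) = finrank k (X' →ₗ[A] Y) :=
  LinearEquiv.finrank_eq
    { toFun := fun f => f ∘ₗ e.symm.toLinearMap
      invFun := fun f => f ∘ₗ e.toLinearMap
      map_add' := fun f g => rfl
      map_smul' := fun c f => rfl
      left_inv := fun f => by ext; simp
      right_inv := fun f => by ext; simp }

/-- The Hom bound embeds the socle of `X` in Cʳ, because dim Hom(S, Cʳ) = r · dim S for simple S in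
the socle. The embedding extends to `X` since functionals extend and lift, and the extension stays
injective because any nonzero kernel would contain a simple submodule of the socle. -/
theorem Separates.exists_injective (hε : Separates A ε) [FiniteDimensional k X]
    [FiniteDimensional k C] (hX : LiftsFunctionals A ε X) (r : ℕ)
    (h : ∀ S : Submodule A X, IsSimpleModule A S → finrank k (S →ₗ[A] X) ≤ r * finrank k S) :
    ∃ j : X →ₗ[A] (Fin r → C), Function.Injective j := by
  have : IsArtinian A X := isArtinian_of_tower k inferInstance
  let soc : Submodule A X := ⨆ S ∈ {S : Submodule A X | IsSimpleModule A S}, S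
  have hss : IsSemisimpleModule A soc :=
    isSemisimpleModule_biSup_of_isSemisimpleModule_submodule fun S hS => by
      have : IsSimpleModule A S := hS
      infer_instance
  have hsoc : LiftsFunctionals A ε soc := hX.of_injective soc.subtype soc.injective_subtype
  obtain ⟨φ, hφ⟩ : ∃ φ : soc →ₗ[A] (Fin r → C), Function.Injective φ := by
    refine exists_injective_of_finrank_hom_le (k := k) fun S hS => ?_
    let i : S →ₗ[A] X := soc.subtype ∘ₗ S.subtype
    have hi : Function.Injective i := soc.injective_subtype.comp S.injective_subtype
    let e := LinearEquiv.ofInjective i hi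
    calc finrank k (S →ₗ[A] soc) ≤ finrank k (S →ₗ[A] X) :=
          LinearMap.finrank_le_finrank_of_injective
            (postcomp_injective (k := k) S soc.injective_subtype)
      _ = finrank k (LinearMap.range i →ₗ[A] X) := finrank_hom_congr_left e
      _ ≤ r * finrank k (LinearMap.range i) := h _ (IsSimpleModule.congr e.symm)
      _ = r * finrank k S := by rw [(e.restrictScalars k).finrank_eq]
      _ = finrank k (S →ₗ[A] (Fin r → C)) := by
          rw [finrank_hom_pi, hε.finrank_hom_eq (hX.of_injective i hi)]
  have hext : ∀ i, ∃ g : X →ₗ[A] C, ∀ x : soc, g x = φ x i := fun i => by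
    obtain ⟨f, hf⟩ := LinearMap.exists_extend (p := soc.restrictScalars k)
      (ε ∘ₗ LinearMap.proj i ∘ₗ φ.restrictScalars k)
    obtain ⟨g, hg⟩ := hX f
    refine ⟨g, fun x => ?_⟩
    -- Both maps on the socle have the same composite with ε, so they agree.
    have := hε.hom_ext (g := g ∘ₗ soc.subtype) (g' := LinearMap.proj i ∘ₗ φ) fun y => by
      exact (hg y).trans (LinearMap.congr_fun hf y)
    exact LinearMap.congr_fun this x
  choose g hg using hext
  refine ⟨LinearMap.pi g, ?_⟩
  rw [← LinearMap.ker_eq_bot]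
  refine (eq_bot_or_exists_atom_le _).resolve_right ?_
  rintro ⟨S, hS, hSk⟩
  have hSs : S ≤ soc := le_biSup (fun S : Submodule A X => S) (isSimpleModule_iff_isAtom.2 hS)
  refine hS.1 ((Submodule.eq_bot_iff _).2 fun x hx => ?_)
  have h0 : φ ⟨x, hSs hx⟩ = 0 := by
    ext i
    rw [← hg]
    exact congrFun (hSk hx) i
  exact congrArg Subtype.val (hφ (h0.trans (map_zero φ).symm))

theorem Separates.finrank_hom_mul_of_equiv (hε : Separates A ε) [FiniteDimensional k X]
    [FiniteDimensional k Y] [FiniteDimensional k C] (hX : LiftsFunctionals A ε X) {n r : ℕ}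
    (hn : 0 < n) (e : (Fin n → Y) ≃ₗ[A] (Fin r → C)) :
    finrank k (X →ₗ[A] Y) * finrank k C = finrank k Y * finrank k X := by
  have h1 : n * finrank k Y = r * finrank k C := by
    simpa [finrank_pi_fintype] using (e.restrictScalars k).finrank_eq
  have h2 : n * finrank k (X →ₗ[A] Y) = r * finrank k X := by
    rw [← hε.finrank_hom_eq hX, ← finrank_hom_pi, ← finrank_hom_pi]
    -- Postcomposition with `e` and with its inverse gives the two inequalities between dim Hom(X,
    -- Yⁿ) and dim Hom(X, Cʳ).
    exact le_antisymm
      (LinearMap.finrank_le_finrank_of_injective (postcomp_injective (k := k) X e.injective))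
      (LinearMap.finrank_le_finrank_of_injective (postcomp_injective (k := k) X e.symm.injective))
  refine Nat.eq_of_mul_eq_mul_left hn ?_
  calc n * (finrank k (X →ₗ[A] Y) * finrank k C) = r * finrank k X * finrank k C := by
        rw [← h2, mul_assoc]
    _ = r * finrank k C * finrank k X := by ring
    _ = n * (finrank k Y * finrank k X) := by rw [← h1, mul_assoc]

end Cofree

/-! ### A power of V is isomorphic to a power of C -/

section Freeness

variable {k H U : Type*} [Field k] [Ring H] [HopfAlgebra k H] [AddCommGroup U] [Module k U]
  {C V : Type*}
  [AddCommGroup C] [Module k C] [Module H C] [IsScalarTower k H C]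
  [Module (TensorAlgebra k U) C] [IsScalarTower k (TensorAlgebra k U) C]
  [AddCommGroup V] [Module k V] [Module H V] [IsScalarTower k H V]
  [Module (TensorAlgebra k U) V] [IsScalarTower k (TensorAlgebra k U) V]
  {ψ : H →ₗ[k] U →ₗ[k] U} {ε : C →ₗ[k] k}

/-- A dimension count on maps out of H ⊗ S shows that each map to Cʳ factors through `j`. By `hmin`
the images of such maps fill every coordinate of Cʳ. -/
theorem surjective_of_finrank_hom [FiniteDimensional k H] [FiniteDimensional k C]
    [FiniteDimensional k V] (hC : IsCompatible ψ C) (hV : IsCompatible ψ V)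
    (hε : Separates (TensorAlgebra k U) ε) {S : Type*} [AddCommGroup S] [Module k S]
    [Module (TensorAlgebra k U) S] [IsScalarTower k (TensorAlgebra k U) S] [FiniteDimensional k S]
    (hmin : ∀ E : Submodule k C,
      (∀ (h : H) (g : S →ₗ[TensorAlgebra k U] C) (s : S), h • g s ∈ E) → E = ⊤)
    {r : ℕ} (hr : r * finrank k S ≤ finrank k (S →ₗ[TensorAlgebra k U] V))
    (j : V →ₗ[TensorAlgebra k U] (Fin r → C)) (hj : Function.Injective j) :
    Function.Surjective j := by
  classical
  have hinj := postcomp_injective (k := k) (Induced ψ S) hj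
  have hsurj : Function.Surjective (postcomp (k := k) (Induced ψ S) j) := by
    refine (LinearMap.injective_iff_surjective_of_finrank_eq_finrank (le_antisymm
      (LinearMap.finrank_le_finrank_of_injective hinj) ?_)).1 hinj
    calc finrank k (Induced ψ S →ₗ[TensorAlgebra k U] (Fin r → C))
        = r * finrank k (Induced ψ S →ₗ[TensorAlgebra k U] C) := finrank_hom_pi _ _
      _ ≤ r * finrank k (Induced ψ S) := Nat.mul_le_mul_left _ hε.finrank_hom_le
      _ = finrank k H * (r * finrank k S) := by rw [Induced.finrank_eq]; ring
      _ ≤ finrank k H * finrank k (S →ₗ[TensorAlgebra k U] V) := Nat.mul_le_mul_left _ hr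
      _ ≤ finrank k (Induced ψ S →ₗ[TensorAlgebra k U] V) := Induced.finrank_mul_finrank_hom_le hV
  have hE : ∀ i, (LinearMap.range (j.restrictScalars k)).comap
      (LinearMap.single k (fun _ : Fin r => C) i) = ⊤ := fun i => by
    refine hmin _ fun h g s => ?_
    -- With g' = ε ⊗ g placed in coordinate i, the induced map is h ⊗ s ↦ ∑ h₍₁₎ ε(h₍₂₎) g(s) = h
    -- g(s) in that coordinate.
    let g' : H →ₗ[k] (S →ₗ[TensorAlgebra k U] (Fin r → C)) :=
      (Coalgebra.counit (R := k) (A := H)).smulRight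
        (LinearMap.single (TensorAlgebra k U) (fun _ : Fin r => C) i ∘ₗ g)
    obtain ⟨G, hG⟩ := hsurj (Induced.liftHom ψ S (Fin r → C) (hC.pi r) g')
    refine ⟨G (Induced.tmul ψ h s), ?_⟩
    change (postcomp (k := k) (Induced ψ S) j G) (Induced.tmul ψ h s) = _
    rw [hG, Induced.liftHom_tmul]
    have := sweedler_counit_right (k := k) ((LinearMap.toSpanSingleton H (Fin r → C)
      (Pi.single i (g s))).restrictScalars k) h
    rw [LinearMap.coe_single, Pi.single_smul]
    refine Eq.trans (sweedler_congr (fun u v => ?_) h) this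
    simp [g', smul_comm u (Coalgebra.counit (R := k) v)]
  intro x
  have hx : x ∈ LinearMap.range (j.restrictScalars k) := by
    rw [← Finset.univ_sum_single x]
    refine Submodule.sum_mem _ fun i _ => ?_
    have : x i ∈ (LinearMap.range (j.restrictScalars k)).comap
      (LinearMap.single k (fun _ : Fin r => C) i) := hE i ▸ Submodule.mem_top
    exact this
  exact hx

/-- Some power of `V` is isomorphic to a power of `C`. -/
theorem exists_pi_equiv_pi [FiniteDimensional k H] [FiniteDimensional k C]
    [FiniteDimensional k V] [Nontrivial V] (hC : IsCompatible ψ C) (hV : IsCompatible ψ V)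
    (hε : Separates (TensorAlgebra k U) ε) (hlift : LiftsFunctionals (TensorAlgebra k U) ε V)
    (hmin : ∀ S : Submodule (TensorAlgebra k U) V, S ≠ ⊥ → ∀ E : Submodule k C,
      (∀ (h : H) (g : S →ₗ[TensorAlgebra k U] C) (s : S), h • g s ∈ E) → E = ⊤) :
    ∃ n r : ℕ, 0 < n ∧ Nonempty ((Fin n → V) ≃ₗ[TensorAlgebra k U] (Fin r → C)) := by
  obtain ⟨S, hS, hmax⟩ := exists_simple_max_ratio (k := k) (A := TensorAlgebra k U) (M := V)
  have : Nontrivial S := IsSimpleModule.nontrivial (TensorAlgebra k U) S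
  -- Here n = dim S and r = dim Hom(S, V); the required bound n · dim Hom(T, V) ≤ r · dim T is the
  -- maximality of the ratio of S.
  obtain ⟨j, hj⟩ := hε.exists_injective (hlift.pi (finrank k S))
    (finrank k (S →ₗ[TensorAlgebra k U] V)) fun T hT => by
      -- Some coordinate embeds the simple submodule `T` of Vⁿ into V, where the maximality of S
      -- applies.
      obtain ⟨i, hi⟩ : ∃ i, (LinearMap.proj i ∘ₗ T.subtype : T →ₗ[TensorAlgebra k U] V) ≠ 0 := by
        by_contra! H
        have := (isSimpleModule_iff_isAtom.1 hT).1
        refine this ((Submodule.eq_bot_iff _).2 fun x hx => ?_)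
        ext i
        exact LinearMap.congr_fun (H i) ⟨x, hx⟩
      let e := LinearEquiv.ofInjective _ (LinearMap.injective_of_ne_zero hi)
      have := hmax _ (IsSimpleModule.congr e.symm)
      rw [finrank_hom_pi, finrank_hom_congr_left e, (e.restrictScalars k).finrank_eq, mul_comm]
      exact this
  refine ⟨_, _, finrank_pos, ⟨LinearEquiv.ofBijective j ⟨hj, ?_⟩⟩⟩
  refine surjective_of_finrank_hom hC (hV.pi _) hε (S := S)
    (hmin S (isSimpleModule_iff_isAtom.1 hS).1) ?_ j hj
  rw [finrank_hom_pi, mul_comm]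

end Freeness

/-! ### Comodules as modules over the tensor algebra of the dual -/

section ComoduleAction

variable {k : Type*} [Field k] {C : Type*} [AddCommGroup C] [Module k C]

/-- The operator `x ↦ ∑ f(x⟨-1⟩) x⟨0⟩` on `C ⊗ W`. -/
noncomputable def evalLeft {W : Type*} [AddCommGroup W] [Module k W] (f : Dual k C) :
    C ⊗[k] W →ₗ[k] W :=
  (TensorProduct.lid k W).toLinearMap ∘ₗ f.rTensor W

/-- The operator `x ↦ ∑ x⟨-1⟩ f(x⟨0⟩)` on `C ⊗ W`. -/
noncomputable def evalRight {W : Type*} [AddCommGroup W] [Module k W] (f : Dual k W) :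
    C ⊗[k] W →ₗ[k] C :=
  (TensorProduct.rid k C).toLinearMap ∘ₗ f.lTensor C

variable {W V : Type*} [AddCommGroup W] [Module k W] [AddCommGroup V] [Module k V]

@[simp] theorem evalLeft_tmul (f : Dual k C) (c : C) (w : W) :
    evalLeft f (c ⊗ₜ[k] w) = f c • w := by simp [evalLeft]

@[simp] theorem evalRight_tmul (f : Dual k W) (c : C) (w : W) :
    evalRight f (c ⊗ₜ[k] w) = f w • c := by simp [evalRight]

theorem evalLeft_ext {x y : C ⊗[k] W} (h : ∀ f : Dual k C, evalLeft f x = evalLeft f y) :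
    x = y := by
  classical
  let b := Basis.ofVectorSpace k C
  apply (TensorProduct.equivFinsuppOfBasisLeft (N := W) b).injective
  ext i
  have key : ∀ z : C ⊗[k] W,
      TensorProduct.equivFinsuppOfBasisLeft b z i = evalLeft (b.coord i) z := fun z => by
    induction z with
    | zero => simp
    | add a b ha hb => rw [map_add, Finsupp.add_apply, ha, hb, map_add]
    | tmul c w => simp
  rw [key, key, h]

theorem evalRight_ext {x y : C ⊗[k] W} (h : ∀ f : Dual k W, evalRight f x = evalRight f y) :
    x = y := by
  apply (TensorProduct.comm k C W).injective
  refine evalLeft_ext fun f => ?_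
  have key : ∀ z : C ⊗[k] W, evalLeft f (TensorProduct.comm k C W z) = evalRight f z := fun z => by
    induction z with
    | zero => simp
    | add a b ha hb => rw [map_add, map_add, ha, hb, map_add]
    | tmul c w => simp
  rw [key, key, h]

theorem evalLeft_lTensor (f : Dual k C) (g : W →ₗ[k] V) (x : C ⊗[k] W) :
    evalLeft f (g.lTensor C x) = g (evalLeft f x) := by
  induction x with
  | zero => simp
  | add a b ha hb => simp only [map_add, ha, hb]
  | tmul c w => simp

theorem apply_evalRight (f : Dual k C) (f' : Dual k W) (x : C ⊗[k] W) :
    f (evalRight f' x) = f' (evalLeft f x) := by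
  induction x with
  | zero => simp
  | add a b ha hb => simp only [map_add, ha, hb]
  | tmul c w => simp [mul_comm]

theorem evalRight_rTensor {B : Type*} [AddCommGroup B] [Module k B] (f : Dual k W) (g : C →ₗ[k] B)
    (x : C ⊗[k] W) : evalRight f (g.rTensor W x) = g (evalRight f x) := by
  induction x with
  | zero => simp
  | add a b ha hb => simp only [map_add, ha, hb]
  | tmul c w => simp

/-- Stability under both families of contractions says that Δ(x) is fixed by a projection onto `E`
in each tensor factor, hence lies in E ⊗ E. -/
theorem isSubcoalgebra_of_eval_mem {Δ : C →ₗ[k] C ⊗[k] C} {E : Submodule k C}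
    (hl : ∀ x ∈ E, ∀ f : Dual k C, evalLeft f (Δ x) ∈ E)
    (hr : ∀ x ∈ E, ∀ f : Dual k C, evalRight f (Δ x) ∈ E) : IsSubcoalgebra Δ E := by
  intro x hx
  obtain ⟨p, hp⟩ := LinearMap.exists_leftInverse_of_injective E.subtype
    (LinearMap.ker_eq_bot.2 E.injective_subtype)
  have hpE : ∀ y ∈ E, (E.subtype ∘ₗ p) y = y := fun y hy =>
    congrArg Subtype.val (LinearMap.congr_fun hp ⟨y, hy⟩)
  have h1 : (E.subtype ∘ₗ p).lTensor C (Δ x) = Δ x := evalLeft_ext fun f => by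
    rw [evalLeft_lTensor, hpE _ (hl x hx f)]
  have h2 : (E.subtype ∘ₗ p).rTensor C (Δ x) = Δ x := evalRight_ext fun f => by
    rw [evalRight_rTensor, hpE _ (hr x hx f)]
  refine ⟨TensorProduct.map p p (Δ x), ?_⟩
  rw [← LinearMap.comp_apply, ← TensorProduct.map_comp]
  conv_rhs => rw [← h1, ← h2, ← LinearMap.comp_apply, LinearMap.lTensor_comp_rTensor]

/-- The operators `w ↦ ∑ f(w⟨-1⟩) w⟨0⟩` attached to a coaction. -/
noncomputable def coactEnd (σ : W →ₗ[k] C ⊗[k] W) : Dual k C →ₗ[k] Module.End k W :=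
  LinearMap.mk₂ k (fun f w => evalLeft f (σ w))
    (fun f f' w => by simp [evalLeft, LinearMap.rTensor_add])
    (fun c f w => by simp [evalLeft, LinearMap.rTensor_smul])
    (fun f w w' => by simp) (fun c f w => by simp)

/-- A coaction makes `W` a module over the tensor algebra of the dual of `C`. -/
noncomputable abbrev coactModule (σ : W →ₗ[k] C ⊗[k] W) : Module (TensorAlgebra k (Dual k C)) W :=
  Module.compHom W (TensorAlgebra.lift k (coactEnd σ)).toRingHom

/-- The action of the tensor algebra of the dual of `C` is the one given by the coaction `σ`. -/
def IsCoactModule [Module (TensorAlgebra k (Dual k C)) W] (σ : W →ₗ[k] C ⊗[k] W) : Prop :=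
  ∀ (f : Dual k C) (w : W), TensorAlgebra.ι k f • w = evalLeft f (σ w)

theorem coactModule_smul_def (σ : W →ₗ[k] C ⊗[k] W) (a : TensorAlgebra k (Dual k C)) (w : W) :
    letI := coactModule σ
    a • w = TensorAlgebra.lift k (coactEnd σ) a w := rfl

theorem isCoactModule_coactModule (σ : W →ₗ[k] C ⊗[k] W) :
    letI := coactModule σ
    IsCoactModule σ := by
  intro f w
  rw [coactModule_smul_def, TensorAlgebra.lift_ι_apply]
  rfl

theorem isScalarTower_coactModule (σ : W →ₗ[k] C ⊗[k] W) :
    letI := coactModule σ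
    IsScalarTower k (TensorAlgebra k (Dual k C)) W := by
  let := coactModule σ
  exact ⟨fun c a x => by simp [coactModule_smul_def]⟩

variable [Module (TensorAlgebra k (Dual k C)) W] [IsScalarTower k (TensorAlgebra k (Dual k C)) W]
  [Module (TensorAlgebra k (Dual k C)) V] [IsScalarTower k (TensorAlgebra k (Dual k C)) V]
  {ρ : W →ₗ[k] C ⊗[k] W} {σ : V →ₗ[k] C ⊗[k] V}

omit [IsScalarTower k (TensorAlgebra k (Dual k C)) W]
  [IsScalarTower k (TensorAlgebra k (Dual k C)) V] in
theorem IsCoactModule.map_ι_smul_iff (hρ : IsCoactModule ρ) (hσ : IsCoactModule σ)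
    (g : W →ₗ[k] V) :
    (∀ (f : Dual k C) (w : W), g (TensorAlgebra.ι k f • w) = TensorAlgebra.ι k f • g w) ↔
      ∀ w, g.lTensor C (ρ w) = σ (g w) := by
  constructor
  · intro h w
    refine evalLeft_ext fun f => ?_
    rw [evalLeft_lTensor, ← hρ, h, hσ]
  · intro h f w
    rw [hρ, hσ, ← h, evalLeft_lTensor]

-- Under W* ⊗ V ≅ Hom(W, V), valid as `W` is finite dimensional, the equalizer condition becomes
-- compatibility with the coactions.
omit [Module (TensorAlgebra k (Dual k C)) W] [IsScalarTower k (TensorAlgebra k (Dual k C)) W]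
  [Module (TensorAlgebra k (Dual k C)) V] [IsScalarTower k (TensorAlgebra k (Dual k C)) V] in
theorem mem_dualCotensor_iff [FiniteDimensional k W] (t : Dual k W ⊗[k] V) :
    t ∈ cotensor (dualCoact ρ) σ ↔
      ∀ w, (dualTensorHom k W V t).lTensor C (ρ w) = σ (dualTensorHom k W V t w) := by
  have hl : ∀ t : Dual k W ⊗[k] V, ∀ w, dualTensorHom k W (C ⊗[k] V)
      (TensorProduct.assoc k _ C V ((dualCoact ρ).rTensor V t)) w =
        (dualTensorHom k W V t).lTensor C (ρ w) := fun t w => by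
    induction t with
    | zero => simp
    | add a b ha hb => simp only [map_add, LinearMap.add_apply, ha, hb, LinearMap.lTensor_add]
    | tmul f v =>
      have h1 : ∀ x : Dual k W ⊗[k] C, dualTensorHom k W (C ⊗[k] V)
          (TensorProduct.assoc k _ C V (x ⊗ₜ v)) w = dualTensorHom k W C x w ⊗ₜ v := fun x => by
        induction x with
        | zero => simp
        | add a b ha hb =>
          simp only [map_add, LinearMap.add_apply, ha, hb, TensorProduct.add_tmul]
        | tmul f' c => simp [TensorProduct.smul_tmul']
      rw [LinearMap.rTensor_tmul, h1, dualCoact_spec]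
      generalize ρ w = y
      induction y with
      | zero => simp
      | add a b ha hb => simp only [map_add, ha, hb, TensorProduct.add_tmul]
      | tmul c w' => simp [TensorProduct.smul_tmul]
  have hr : ∀ t : Dual k W ⊗[k] V, ∀ w, dualTensorHom k W (C ⊗[k] V)
      (σ.lTensor (Dual k W) t) w = σ (dualTensorHom k W V t w) := fun t w => by
    induction t with
    | zero => simp
    | add a b ha hb => simp only [map_add, LinearMap.add_apply, ha, hb]
    | tmul f v => simp
  rw [cotensor, LinearMap.mem_eqLocus,
    ← (dualTensorHomEquiv k W (C ⊗[k] V)).injective.eq_iff, LinearMap.ext_iff]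
  refine forall_congr' fun w => ?_
  rw [← hl t w, ← hr t w]
  rfl

theorem IsCoactModule.finrank_cotensor [FiniteDimensional k W] (hρ : IsCoactModule ρ)
    (hσ : IsCoactModule σ) : finrank k (cotensor (dualCoact ρ) σ) =
      finrank k (W →ₗ[TensorAlgebra k (Dual k C)] V) := by
  let L := LinearMap.range
    (LinearMap.restrictScalarsₗ k (TensorAlgebra k (Dual k C)) W V k)
  have hL : L = (cotensor (dualCoact ρ) σ).map (dualTensorHomEquiv k W V).toLinearMap := by
    ext g
    constructor
    · rintro ⟨g, rfl⟩
      refine ⟨(dualTensorHomEquiv k W V).symm (g.restrictScalars k), ?_,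
        LinearEquiv.apply_symm_apply _ _⟩
      have h := LinearEquiv.apply_symm_apply (dualTensorHomEquiv k W V) (g.restrictScalars k)
      refine (mem_dualCotensor_iff _).2 ?_
      rw [← (hρ.map_ι_smul_iff hσ _)]
      intro f w
      change (dualTensorHomEquiv k W V _) _ = _ • (dualTensorHomEquiv k W V _) w
      rw [h]
      exact g.map_smul _ _
    · rintro ⟨t, ht, rfl⟩
      have := (hρ.map_ι_smul_iff hσ _).2 ((mem_dualCotensor_iff _).1 ht)
      exact ⟨linearMapOfι (dualTensorHom k W V t) this, rfl⟩
  rw [← LinearEquiv.finrank_map_eq (dualTensorHomEquiv k W V), ← hL]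
  exact LinearMap.finrank_range_of_inj (LinearMap.restrictScalars_injective k)

end ComoduleAction

/-! ### A coalgebra as a module over its dual -/

section Coalgebra

variable {k : Type*} [Field k] {C : Type*} [AddCommGroup C] [Module k C]
  [Module (TensorAlgebra k (Dual k C)) C] [IsScalarTower k (TensorAlgebra k (Dual k C)) C]
  {Δ : C →ₗ[k] C ⊗[k] C} {ε : C →ₗ[k] k}

omit [IsScalarTower k (TensorAlgebra k (Dual k C)) C] in
theorem counit_ι_smul (hΔ : IsCoactModule Δ) (hε : ∀ c, evalRight ε (Δ c) = c) (f : Dual k C)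
    (c : C) : ε (TensorAlgebra.ι k f • c) = f c := by
  rw [hΔ, ← apply_evalRight, hε]

-- The right counit axiom gives ε(f · c) = f(c), so the generators alone already detect c.
omit [IsScalarTower k (TensorAlgebra k (Dual k C)) C] in
theorem separates_counit (hΔ : IsCoactModule Δ) (hε : ∀ c, evalRight ε (Δ c) = c) :
    Separates (TensorAlgebra k (Dual k C)) ε := fun c hc => by
  rw [← Module.forall_dual_apply_eq_zero_iff k]
  intro f
  rw [← counit_ι_smul hΔ hε, hc]

/-- The lift of f is w ↦ ∑ w⟨-1⟩ f(w⟨0⟩). It commutes with the coactions by coassociativity of `ρ`,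
and ε returns f by the counit axiom of `ρ`. -/
theorem LeftComodule.liftsFunctionals (hΔ : IsCoactModule Δ) {W : Type*} [AddCommGroup W]
    [Module k W] [Module (TensorAlgebra k (Dual k C)) W]
    [IsScalarTower k (TensorAlgebra k (Dual k C)) W] (ρ : LeftComodule Δ ε W)
    (hρ : IsCoactModule ρ.coact) : LiftsFunctionals (TensorAlgebra k (Dual k C)) ε W := by
  intro f
  have h1 : ∀ w, (evalRight f ∘ₗ ρ.coact).lTensor C (ρ.coact w) =
      Δ ((evalRight f ∘ₗ ρ.coact) w) := fun w => by
    have h := LinearMap.congr_fun ρ.coassoc w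
    rw [LinearMap.lTensor_comp, LinearMap.comp_apply]
    simp only [LinearMap.comp_apply, LinearEquiv.coe_coe] at h ⊢
    rw [← h]
    generalize ρ.coact w = x
    induction x with
    | zero => simp
    | add a b ha hb => simp only [map_add, ha, hb]
    | tmul c w' =>
      rw [LinearMap.rTensor_tmul, evalRight_tmul, map_smul]
      generalize Δ c = y
      induction y with
      | zero => simp
      | add a b ha hb => simp only [map_add, ha, hb, TensorProduct.add_tmul, smul_add]
      | tmul c c' => simp
  refine ⟨linearMapOfι _ ((hρ.map_ι_smul_iff hΔ _).2 h1), fun w => ?_⟩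
  change ε (evalRight f (ρ.coact w)) = f w
  rw [apply_evalRight]
  exact congrArg f (LinearMap.congr_fun ρ.counit w)

end Coalgebra

/-! ### Coalgebras with an equivariant H-action -/

section ModuleCoalgebra

variable {k H : Type*} [Field k] [Ring H] [HopfAlgebra k H] {C : Type*} [AddCommGroup C]
  [Module k C] [Module H C] [IsScalarTower k H C]

/-- The coaction `σ` satisfies `σ(h v) = ∑ h₍₁₎ v⟨-1⟩ ⊗ h₍₂₎ v⟨0⟩`. -/
def IsEquivariant {V : Type*} [AddCommGroup V] [Module k V] [Module H V] [IsScalarTower k H V]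
    (σ : V →ₗ[k] C ⊗[k] V) : Prop :=
  ∀ (h : H) (v : V), σ (h • v) = sweedler k
    (fun u w => TensorProduct.map (Algebra.lsmul k k C u) (Algebra.lsmul k k V w) (σ v)) h

variable (k H C) in
/-- The transpose of the action of `H` on `C`. -/
noncomputable def transposeAct : H →ₗ[k] Dual k C →ₗ[k] Dual k C :=
  LinearMap.mk₂ k (fun h f => f ∘ₗ Algebra.lsmul k k C h)
    (fun h h' f => by ext; simp) (fun c h f => by ext; simp)
    (fun h f f' => by ext; simp) (fun c h f => by ext; simp)

theorem transposeAct_apply (h : H) (f : Dual k C) (c : C) :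
    transposeAct k H C h f c = f (h • c) := rfl

section

variable {V : Type*} [AddCommGroup V] [Module k V] [Module H V] [IsScalarTower k H V]

theorem evalLeft_map (u w : H) (f : Dual k C) (x : C ⊗[k] V) :
    evalLeft f (TensorProduct.map (Algebra.lsmul k k C u) (Algebra.lsmul k k V w) x) =
      w • evalLeft (transposeAct k H C u f) x := by
  induction x with
  | zero => simp
  | add a b ha hb => simp only [map_add, ha, hb, smul_add]
  | tmul c v => simp [transposeAct_apply, smul_comm w]

theorem evalRight_map (u w : H) (f : Dual k V) (x : C ⊗[k] V) :
    evalRight f (TensorProduct.map (Algebra.lsmul k k C u) (Algebra.lsmul k k V w) x) =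
      u • evalRight (transposeAct k H V w f) x := by
  induction x with
  | zero => simp
  | add a b ha hb => simp only [map_add, ha, hb, smul_add]
  | tmul c v => simp [transposeAct_apply, smul_comm u]

theorem IsEquivariant.isCompatible [Module (TensorAlgebra k (Dual k C)) V]
    {σ : V →ₗ[k] C ⊗[k] V} (hσ : IsEquivariant (H := H) σ) (hV : IsCoactModule σ) :
    IsCompatible (transposeAct k H C) V := fun f h y => by
  rw [hV, hσ, map_sweedler]
  refine sweedler_congr (fun u v => ?_) h
  rw [evalLeft_map, hV]

end

variable {Δ : C →ₗ[k] C ⊗[k] C} {ε : C →ₗ[k] k}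

/-- The span of all h · g(s) is nonzero, H-stable and a subcoalgebra, so minimality applies to it.
Left contractions preserve it because g is linear over the tensor algebra; right contractions
replace g by another map S → C. -/
theorem eq_top_of_smul_hom_mem [Module (TensorAlgebra k (Dual k C)) C]
    [IsScalarTower k (TensorAlgebra k (Dual k C)) C] (hC : IsCoactModule Δ)
    (hΔ : IsEquivariant (H := H) Δ) (hε : ∀ c, evalRight ε (Δ c) = c)
    (hmin : ∀ E : Submodule k C, E ≠ ⊥ → IsSubcoalgebra Δ E → (∀ h : H, ∀ c ∈ E, h • c ∈ E) →
      E = ⊤)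
    {S : Type*} [AddCommGroup S] [Module k S] [Module (TensorAlgebra k (Dual k C)) S]
    [IsScalarTower k (TensorAlgebra k (Dual k C)) S] [Nontrivial S] (hS : LiftsFunctionals (TensorAlgebra k (Dual k C)) ε S)
    (E : Submodule k C)
    (hE : ∀ (h : H) (g : S →ₗ[TensorAlgebra k (Dual k C)] C) (s : S), h • g s ∈ E) : E = ⊤ := by
  let X : Set C := {c | ∃ (h : H) (g : S →ₗ[TensorAlgebra k (Dual k C)] C) (s : S), h • g s = c}
  have hX : ∀ (h : H) (g : S →ₗ[TensorAlgebra k (Dual k C)] C) (s : S),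
      h • g s ∈ Submodule.span k X := fun h g s => Submodule.subset_span ⟨h, g, s, rfl⟩
  have hle : Submodule.span k X ≤ E := Submodule.span_le.2 (by
    rintro _ ⟨h, g, s, rfl⟩
    exact hE h g s)
  have hsw : ∀ (B : H → H → C) (h : H), (∀ u v, B u v ∈ Submodule.span k X) →
      sweedler k B h ∈ Submodule.span k X := fun B h hB => Submodule.sum_mem _ fun i _ => hB _ _
  refine top_le_iff.1 (le_trans (hmin _ ?_ ?_ ?_).ge hle)
  · obtain ⟨s, hs⟩ := exists_ne (0 : S)
    obtain ⟨f, hf⟩ : ∃ f : Dual k S, f s ≠ 0 := by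
      by_contra! H
      exact hs ((Module.forall_dual_apply_eq_zero_iff k s).1 H)
    obtain ⟨g, hg⟩ := hS f
    intro hbot
    have := hX 1 g s
    rw [hbot, Submodule.mem_bot, one_smul] at this
    rw [← hg, this, map_zero] at hf
    exact hf rfl
  · refine isSubcoalgebra_of_eval_mem (fun x hx f => ?_) (fun x hx f => ?_)
    · induction hx using Submodule.span_induction with
      | mem x hx =>
        obtain ⟨h, g, s, rfl⟩ := hx
        rw [hΔ, map_sweedler]
        refine hsw _ _ fun u v => ?_
        rw [evalLeft_map, ← hC, ← map_smul]
        exact hX _ _ _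
      | zero => simp
      | add x y _ _ hx hy => rw [map_add, map_add]; exact add_mem hx hy
      | smul c x _ hx => rw [map_smul, map_smul]; exact Submodule.smul_mem _ _ hx
    · induction hx using Submodule.span_induction with
      | mem x hx =>
        obtain ⟨h, g, s, rfl⟩ := hx
        rw [hΔ, map_sweedler]
        refine hsw _ _ fun u v => ?_
        rw [evalRight_map]
        -- The right contraction of Δ(g(s)) by a functional f' is g'(s), where g' lifts f' ∘ g:
        -- every functional φ takes the value f'(g(φ · s)) on both.
        obtain ⟨g', hg'⟩ := hS (transposeAct k H C v f ∘ₗ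
          g.restrictScalars k)
        have : evalRight (transposeAct k H C v f) (Δ (g s)) = g' s := by
          rw [← sub_eq_zero, ← Module.forall_dual_apply_eq_zero_iff k]
          intro φ
          rw [map_sub, apply_evalRight, ← counit_ι_smul hC hε φ (g' s), ← map_smul, hg', ← hC,
            ← map_smul]
          simp
        rw [this]
        exact hX _ _ _
      | zero => simp
      | add x y _ _ hx hy => rw [map_add, map_add]; exact add_mem hx hy
      | smul c x _ hx => rw [map_smul, map_smul]; exact Submodule.smul_mem _ _ hx
  · intro h c hc
    induction hc using Submodule.span_induction with
    | mem x hx =>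
      obtain ⟨h', g, s, rfl⟩ := hx
      rw [← mul_smul]
      exact hX _ _ _
    | zero => simp
    | add x y _ _ hx hy => rw [smul_add]; exact add_mem hx hy
    | smul c x _ hx => rw [smul_comm]; exact Submodule.smul_mem _ _ hx

/-- The dimension formula for a coalgebra `C` with an action of `H` that has no proper nonzero
stable subcoalgebras. -/
theorem finrank_cotensor_mul_finrank [FiniteDimensional k H] [FiniteDimensional k C]
    (hΔ : IsEquivariant (H := H) Δ) (hε : ∀ c, evalRight ε (Δ c) = c)
    (hmin : ∀ E : Submodule k C, E ≠ ⊥ → IsSubcoalgebra Δ E → (∀ h : H, ∀ c ∈ E, h • c ∈ E) →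
      E = ⊤)
    {W : Type*} [AddCommGroup W] [Module k W] [FiniteDimensional k W] (ρ : LeftComodule Δ ε W)
    {V : Type*} [AddCommGroup V] [Module k V] [Module H V] [IsScalarTower k H V]
    [FiniteDimensional k V] (σ : LeftComodule Δ ε V) (hσ : IsEquivariant (H := H) σ.coact) :
    finrank k (cotensor (dualCoact ρ.coact) σ.coact) * finrank k C =
      finrank k V * finrank k W := by
  -- A simple submodule of V exists only when V ≠ 0; for V = 0 both sides vanish.
  rcases subsingleton_or_nontrivial V with hV | hV
  · have h0 : finrank k V = 0 := finrank_zero_of_subsingleton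
    have := Submodule.finrank_le (cotensor (dualCoact ρ.coact) σ.coact)
    rw [finrank_tensorProduct, h0, mul_zero, Nat.le_zero] at this
    rw [this, h0, zero_mul, zero_mul]
  let := coactModule Δ
  let := coactModule ρ.coact
  let := coactModule σ.coact
  have hC' := isCoactModule_coactModule Δ
  have hW' := isCoactModule_coactModule ρ.coact
  have hV' := isCoactModule_coactModule σ.coact
  have := isScalarTower_coactModule Δ
  have := isScalarTower_coactModule ρ.coact
  have := isScalarTower_coactModule σ.coact
  have hlift := σ.liftsFunctionals hC' hV'
  obtain ⟨n, r, hn, ⟨e⟩⟩ := exists_pi_equiv_pi (hΔ.isCompatible hC') (hσ.isCompatible hV')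
    (separates_counit hC' hε) hlift fun S hS => by
      have : Nontrivial S := Submodule.nontrivial_iff_ne_bot.2 hS
      exact eq_top_of_smul_hom_mem hC' hΔ hε hmin
        (hlift.of_injective S.subtype S.injective_subtype)
  rw [hW'.finrank_cotensor hV']
  exact (separates_counit hC' hε).finrank_hom_mul_of_equiv (ρ.liftsFunctionals hC' hW') hn e

end ModuleCoalgebra

/-! ### The antipode and the adjoint action under comultiplication -/

section Antipode

variable {k H : Type*} [Field k] [Ring H] [HopfAlgebra k H]

open HopfAlgebra

theorem sweedler_comul_antipode_mul_comul (h : H) :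
    sweedler k (fun u v => sweedler k (fun a b => antipode k b ⊗ₜ[k] antipode k a) u *
      Coalgebra.comul (R := k) v) h = algebraMap k (H ⊗[k] H) (Coalgebra.counit h) := by
  have htri : IsTrilin k (fun a b v : H => (antipode k b ⊗ₜ[k] antipode k a) *
      Coalgebra.comul (R := k) v) :=
    ⟨fun z => ⟨by simp [TensorProduct.tmul_add, add_mul], by simp,
      by simp [TensorProduct.add_tmul, add_mul], by simp [← TensorProduct.smul_tmul']⟩,
    fun z => ⟨by simp [TensorProduct.add_tmul, add_mul], by simp [← TensorProduct.smul_tmul'],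
      by simp [mul_add], by simp⟩⟩
  have htri' (a : H) : IsTrilin k
      (fun b c d : H => (antipode k b * c) ⊗ₜ[k] (antipode k a * d)) :=
    ⟨fun z => ⟨by simp [TensorProduct.add_tmul, add_mul], by simp [← TensorProduct.smul_tmul'],
      by simp [TensorProduct.add_tmul, mul_add], by simp [← TensorProduct.smul_tmul']⟩,
    fun z => ⟨by simp [TensorProduct.add_tmul, mul_add], by simp [← TensorProduct.smul_tmul'],
      by simp [TensorProduct.tmul_add, mul_add], by simp⟩⟩
  have h1 (u v : H) : sweedler k (fun a b => antipode k b ⊗ₜ[k] antipode k a) u *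
      Coalgebra.comul (R := k) v =
      sweedler k (fun a b => (antipode k b ⊗ₜ[k] antipode k a) * Coalgebra.comul (R := k) v) u :=
    map_sweedler (AddMonoidHom.mulRight (Coalgebra.comul (R := k) v)) _ u
  have h2 (a w : H) : sweedler k (fun b v => (antipode k b ⊗ₜ[k] antipode k a) *
      Coalgebra.comul (R := k) v) w = 1 ⊗ₜ[k] (antipode k a * w) := by
    have h3 (b v : H) : (antipode k b ⊗ₜ[k] antipode k a) * Coalgebra.comul (R := k) v =
        sweedler k (fun c d => (antipode k b * c) ⊗ₜ[k] (antipode k a * d)) v := by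
      rw [comul_eq_sweedler (k := k) v]
      refine (map_sweedler (k := k) (AddMonoidHom.mulLeft (antipode k b ⊗ₜ[k] antipode k a))
        (fun c d => c ⊗ₜ[k] d) v).trans (sweedler_congr (k := k) (fun c d => ?_) v)
      simp
    have h4 (x d : H) : sweedler k (fun b c => (antipode k b * c) ⊗ₜ[k] (antipode k a * d)) x =
        Coalgebra.counit (R := k) x • (1 ⊗ₜ[k] (antipode k a * d)) := by
      have := map_sweedler (k := k) ((TensorProduct.mk k H H).flip (antipode k a * d))
        (fun b c => antipode k b * c) x
      rw [sweedler_antipode_mul, Algebra.algebraMap_eq_smul_one, map_smul] at this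
      exact this.symm
    simp only [h3]
    rw [← sweedler_coassoc (htri' a)]
    simp only [h4]
    exact sweedler_counit_left (TensorProduct.mk k H H 1 ∘ₗ LinearMap.mulLeft k (antipode k a)) w
  simp only [h1]
  rw [sweedler_coassoc htri]
  simp only [h2]
  have := map_sweedler (k := k) (TensorProduct.mk k H H 1) (fun u v => antipode k u * v) h
  rw [sweedler_antipode_mul, Algebra.algebraMap_eq_smul_one, map_smul] at this
  rw [Algebra.algebraMap_eq_smul_one]
  exact this.symm

/-- Both sides are convolution inverses of Δ, one on the left and one on the right, so they
coincide. -/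
theorem comul_antipode (h : H) : Coalgebra.comul (antipode k h) =
    sweedler k (fun u v => antipode k v ⊗ₜ[k] antipode k u) h := by
  let G : H →ₗ[k] H ⊗[k] H := TensorProduct.map (antipode k) (antipode k) ∘ₗ
    (TensorProduct.comm k H H).toLinearMap ∘ₗ Coalgebra.comul
  have hG (x : H) : G x = sweedler k (fun u v => antipode k v ⊗ₜ[k] antipode k u) x := by
    change (TensorProduct.map (antipode k) (antipode k) ∘ₗ
      (TensorProduct.comm k H H).toLinearMap) (Coalgebra.comul x) = _
    rw [comul_eq_sweedler, map_sweedler]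
    rfl
  have hl : WithConv.toConv G * WithConv.toConv (Coalgebra.comul (R := k) (A := H)) = 1 := by
    ext x
    rw [(Coalgebra.Repr.arbitrary k x).convMul_apply]
    have := sweedler_comul_antipode_mul_comul (k := k) x
    simp only [← hG] at this
    simpa [sweedler] using this
  have := left_inv_eq_right_inv hl LinearMap.comul_right_inv
  rw [← hG]
  exact (LinearMap.congr_fun (WithConv.toConv_injective this) h).symm

theorem ad_eq_sweedler (h a : H) :
    ad k H h a = sweedler k (fun u v => u * a * antipode k v) h :=
  ad_apply h a _

theorem isBilin_conj (a : H) : IsBilin k (fun u v : H => u * a * antipode k v) :=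
  ⟨by simp [add_mul], by simp, by simp [mul_add], by simp⟩

theorem ad_one (a : H) : ad k H 1 a = a := by
  rw [ad_eq_sweedler, sweedler_one (isBilin_conj a)]
  simp

theorem ad_mul (g h a : H) : ad k H (g * h) a = ad k H g (ad k H h a) := by
  rw [ad_eq_sweedler, sweedler_mul (isBilin_conj a), ad_eq_sweedler g]
  refine sweedler_congr (k := k) (fun x y => ?_) g
  rw [ad_eq_sweedler h]
  have := map_sweedler (k := k) (LinearMap.mulLeft k x ∘ₗ LinearMap.mulRight k (antipode k y))
    (fun u v => u * a * antipode k v) h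
  simp only [LinearMap.comp_apply, LinearMap.mulLeft_apply, LinearMap.mulRight_apply] at this
  rw [mul_assoc x, this]
  refine sweedler_congr (k := k) (fun u v => ?_) h
  simp [antipode_mul_antidistrib, mul_assoc]

theorem counit_ad (h a : H) : Coalgebra.counit (R := k) (ad k H h a) =
    Coalgebra.counit (R := k) h * Coalgebra.counit (R := k) a := by
  rw [ad_eq_sweedler, map_sweedler]
  have := sweedler_counit_left ((Coalgebra.counit (R := k) (A := H)).smulRight
    (Coalgebra.counit (R := k) a)) h
  refine Eq.trans (sweedler_congr (k := k) (fun u v => ?_) h) this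
  simp
  ring

theorem isTrilin_conj (t : H ⊗[k] H) : IsTrilin k (fun x u v : H =>
    (x ⊗ₜ[k] (1 : H)) * (ad k H u).lTensor H t * (antipode k v ⊗ₜ[k] (1 : H))) :=
  ⟨fun z => ⟨by simp [TensorProduct.add_tmul, add_mul], by simp [← TensorProduct.smul_tmul'],
      by simp [LinearMap.lTensor_add, add_mul, mul_add], by simp [LinearMap.lTensor_smul]⟩,
    fun z => ⟨by simp [LinearMap.lTensor_add, add_mul, mul_add], by simp [LinearMap.lTensor_smul],
      by simp [TensorProduct.add_tmul, mul_add], by simp [← TensorProduct.smul_tmul']⟩⟩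

theorem lTensor_ad (u : H) (t : H ⊗[k] H) : (ad k H u).lTensor H t =
    sweedler k (fun c d => ((1 : H) ⊗ₜ[k] c) * t * ((1 : H) ⊗ₜ[k] antipode k d)) u := by
  induction t with
  | zero => simp [sweedler]
  | add a b ha hb => rw [map_add, ha, hb, ← sweedler_fun_add]; simp only [mul_add, add_mul]
  | tmul p q =>
    rw [LinearMap.lTensor_tmul, ad_eq_sweedler, ← TensorProduct.mk_apply, map_sweedler]
    simp

theorem rTensor_ad (u : H) (t : H ⊗[k] H) : (ad k H u).rTensor H t =
    sweedler k (fun c d => (c ⊗ₜ[k] (1 : H)) * t * (antipode k d ⊗ₜ[k] (1 : H))) u := by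
  induction t with
  | zero => simp [sweedler]
  | add a b ha hb => rw [map_add, ha, hb, ← sweedler_fun_add]; simp only [mul_add, add_mul]
  | tmul p q =>
    rw [LinearMap.rTensor_tmul, ad_eq_sweedler, ← TensorProduct.mk_apply, ← LinearMap.flip_apply,
      map_sweedler]
    simp

/-- Expanding Δ(g₍₁₎ a S(g₍₂₎)) gives ∑ g₍₁₎ a₍₁₎ S(g₍₄₎) ⊗ g₍₂₎ a₍₂₎ S(g₍₃₎); the inner pair is an
adjoint action on the second factor. The outer S(g₍₄₎) is the obstruction to equivariance of Δ that
the R-matrix removes. -/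
theorem comul_ad (g a : H) : Coalgebra.comul (R := k) (ad k H g a) =
    sweedler k (fun x y => sweedler k (fun u v => (x ⊗ₜ[k] (1 : H)) *
      (ad k H u).lTensor H (Coalgebra.comul a) * (antipode k v ⊗ₜ[k] (1 : H))) y) g := by
  rw [← sweedler_coassoc (isTrilin_conj _), ad_eq_sweedler, map_sweedler]
  generalize ht : Coalgebra.comul (R := k) a = t
  have htri : IsTrilin k (fun x u v : H => Coalgebra.comul (R := k) x * t *
      (antipode k v ⊗ₜ[k] antipode k u)) :=
    ⟨fun z => ⟨by simp [add_mul], by simp, by simp [TensorProduct.tmul_add, mul_add], by simp⟩,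
    fun z => ⟨by simp [TensorProduct.tmul_add, mul_add], by simp,
      by simp [TensorProduct.add_tmul, mul_add], by simp [← TensorProduct.smul_tmul']⟩⟩
  have htri' (v : H) : IsTrilin k (fun c d u : H => (c ⊗ₜ[k] d) * t *
      (antipode k v ⊗ₜ[k] antipode k u)) :=
    ⟨fun z => ⟨by simp [TensorProduct.add_tmul, add_mul], by simp [← TensorProduct.smul_tmul'],
      by simp [TensorProduct.tmul_add, add_mul], by simp⟩,
    fun z => ⟨by simp [TensorProduct.tmul_add, add_mul], by simp,
      by simp [TensorProduct.tmul_add, mul_add], by simp⟩⟩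
  have h1 (x y : H) : Coalgebra.comul (R := k) (x * a * antipode k y) = sweedler k (fun u v =>
      Coalgebra.comul (R := k) x * t * (antipode k v ⊗ₜ[k] antipode k u)) y := by
    rw [Bialgebra.comul_mul, Bialgebra.comul_mul, ht, comul_antipode]
    exact map_sweedler (k := k) (AddMonoidHom.mulLeft (Coalgebra.comul (R := k) x * t)) _ y
  have h2 (v x u : H) : Coalgebra.comul (R := k) x * t * (antipode k v ⊗ₜ[k] antipode k u) =
      sweedler k (fun c d => (c ⊗ₜ[k] d) * t * (antipode k v ⊗ₜ[k] antipode k u)) x := by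
    conv_lhs => rw [comul_eq_sweedler, mul_assoc]
    rw [show ∀ z, z * (t * (antipode k v ⊗ₜ[k] antipode k u)) = AddMonoidHom.mulRight
      (t * (antipode k v ⊗ₜ[k] antipode k u)) z from fun _ => rfl, map_sweedler]
    simp [mul_assoc]
  simp only [h1]
  rw [← sweedler_coassoc htri]
  refine sweedler_congr (k := k) (fun p v => ?_) g
  simp only [h2]
  rw [sweedler_coassoc (htri' v)]
  refine sweedler_congr (k := k) (fun c q => ?_) p
  rw [lTensor_ad, show ∀ z, (c ⊗ₜ[k] (1 : H)) * z * (antipode k v ⊗ₜ[k] (1 : H)) =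
    AddMonoidHom.mulRight (antipode k v ⊗ₜ[k] (1 : H)) (AddMonoidHom.mulLeft (c ⊗ₜ[k] (1 : H)) z)
    from fun _ => rfl, map_sweedler, map_sweedler]
  refine sweedler_congr (k := k) (fun d u => ?_) q
  simp only [AddMonoidHom.coe_mulRight, AddMonoidHom.coe_mulLeft, mul_assoc]
  rw [Algebra.TensorProduct.tmul_mul_tmul, ← mul_assoc (c ⊗ₜ[k] (1 : H)),
    Algebra.TensorProduct.tmul_mul_tmul]
  simp

end Antipode

/-! ### Equivariance and counit of the transmuted comultiplication -/

section Twist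

variable {k H : Type*} [Field k] [Ring H] [HopfAlgebra k H]

open HopfAlgebra

theorem twist_conj (r t : H ⊗[k] H) (x u v : H) :
    twist r ((x ⊗ₜ[k] (1 : H)) * (ad k H u).lTensor H t * (antipode k v ⊗ₜ[k] (1 : H))) =
      (x ⊗ₜ[k] (1 : H)) * twist (r * (u ⊗ₜ[k] v)) t := by
  induction t with
  | zero => simp
  | add a b ha hb => simp only [map_add, mul_add, add_mul, ha, hb]
  | tmul p q =>
    induction r with
    | zero => simp
    | add a b ha hb => simp only [map_add, mul_add, add_mul, LinearMap.add_apply, ha, hb]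
    | tmul s s' => simp [twist_tmul, antipode_mul_antidistrib, ad_mul, mul_assoc]

theorem twist_tmul_mul (r t : H ⊗[k] H) (u v : H) :
    twist ((v ⊗ₜ[k] u) * r) t = (ad k H v).lTensor H (twist r t) * (antipode k u ⊗ₜ[k] (1 : H)) := by
  induction t with
  | zero => simp
  | add a b ha hb => simp only [map_add, add_mul, ha, hb]
  | tmul p q =>
    induction r with
    | zero => simp
    | add a b ha hb => simp only [map_add, mul_add, add_mul, LinearMap.add_apply, ha, hb]
    | tmul s s' => simp [twist_tmul, antipode_mul_antidistrib, ad_mul, mul_assoc]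

/-- By `twist_conj` the factors left over in `comul_ad` are absorbed as R Δ(y). Rewriting this as
Δᶜᵒᵖ(y) R and releasing the factors with `twist_tmul_mul` puts them in the order required by the
diagonal adjoint action. -/
theorem comulR_ad {R : H ⊗[k] H} (hR : IsRMatrix R) (g a : H) : comulR R (ad k H g a) =
    sweedler k (fun x y => TensorProduct.map (ad k H x) (ad k H y) (comulR R a)) g := by
  change twist R (Coalgebra.comul (ad k H g a)) = sweedler k
    (fun x y => TensorProduct.map (ad k H x) (ad k H y) (twist R (Coalgebra.comul a))) g
  rw [comul_ad]
  generalize Coalgebra.comul (R := k) a = t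
  have h1 (x y : H) : TensorProduct.map (ad k H x) (ad k H y) (twist R t) =
      sweedler k (fun u v => (u ⊗ₜ[k] (1 : H)) * (ad k H y).lTensor H (twist R t) *
        (antipode k v ⊗ₜ[k] (1 : H))) x := by
    rw [← rTensor_ad, ← LinearMap.rTensor_comp_lTensor, LinearMap.comp_apply]
  have htri : IsTrilin k (fun u v y : H => (u ⊗ₜ[k] (1 : H)) * (ad k H y).lTensor H (twist R t) *
        (antipode k v ⊗ₜ[k] (1 : H))) :=
    ⟨fun z => ⟨by simp [TensorProduct.add_tmul, add_mul], by simp [← TensorProduct.smul_tmul'],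
      by simp [TensorProduct.add_tmul, mul_add], by simp [← TensorProduct.smul_tmul']⟩,
    fun z => ⟨by simp [TensorProduct.add_tmul, mul_add], by simp [← TensorProduct.smul_tmul'],
      by simp [LinearMap.lTensor_add, add_mul, mul_add], by simp [LinearMap.lTensor_smul]⟩⟩
  simp only [h1]
  rw [sweedler_coassoc htri, map_sweedler]
  refine sweedler_congr (k := k) (fun x y => ?_) g
  rw [map_sweedler]
  simp only [twist_conj]
  let f : H ⊗[k] H →ₗ[k] H ⊗[k] H :=
    LinearMap.mulLeft k (x ⊗ₜ[k] (1 : H)) ∘ₗ (twist (k := k) (H := H)).flip t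
  have h2 : sweedler k (fun u v => (x ⊗ₜ[k] (1 : H)) * twist (R * (u ⊗ₜ[k] v)) t) y =
      f (R * Coalgebra.comul y) := by
    conv_rhs => rw [comul_eq_sweedler]
    exact (map_sweedler (f ∘ₗ LinearMap.mulLeft k R) _ y).symm
  rw [h2, hR.mul_comul, comul_eq_sweedler]
  have := map_sweedler (k := k) (f ∘ₗ LinearMap.mulRight k R ∘ₗ (TensorProduct.comm k H H).toLinearMap)
    (fun u v => u ⊗ₜ[k] v) y
  refine this.trans (sweedler_congr (k := k) (fun u v => ?_) y)
  simp [f, twist_tmul_mul, mul_assoc]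

/-- Applying ε to the first leg of (Δ ⊗ id) R = R¹³ R²³ gives R = (1 ⊗ (ε ⊗ id) R) R, and the
invertible R cancels. -/
theorem evalLeft_counit_eq_one {R : H ⊗[k] H} (hR : IsRMatrix R) :
    evalLeft (Coalgebra.counit (R := k) (A := H)) R = 1 := by
  have h1 : ∀ r : H ⊗[k] H, evalLeft (Coalgebra.counit (R := k) (A := H))
      (TensorProduct.assoc k H H H ((Coalgebra.comul (R := k) (A := H)).rTensor H r)) = r :=
    fun r => by
      induction r with
      | zero => simp
      | add a b ha hb => simp only [map_add, ha, hb]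
      | tmul s t =>
        have := sweedler_counit_left ((TensorProduct.mk k H H).flip t) s
        rw [LinearMap.rTensor_tmul, comul_eq_sweedler]
        simpa [sweedler, TensorProduct.sum_tmul] using this
  have h2 : ∀ x : H ⊗[k] (H ⊗[k] H), evalLeft (Coalgebra.counit (R := k) (A := H))
      (x * ((1 : H) ⊗ₜ[k] R)) = evalLeft (Coalgebra.counit (R := k) (A := H)) x * R := fun x => by
    induction x with
    | zero => simp
    | add a b ha hb => simp only [map_add, add_mul, ha, hb]
    | tmul s t => simp
  have h3 := congrArg (evalLeft (Coalgebra.counit (R := k) (A := H))) hR.comul_left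
  rw [h1, h2, evalLeft_lTensor] at h3
  have h4 : (1 : H) ⊗ₜ[k] evalLeft (Coalgebra.counit (R := k) (A := H)) R = (1 : H) ⊗ₜ[k] (1 : H) :=
    hR.isUnit.mul_right_cancel (h3.symm.trans (one_mul R).symm)
  simpa using congrArg (evalLeft (Coalgebra.counit (R := k) (A := H))) h4

theorem evalRight_counit_comulR {R : H ⊗[k] H} (hR : IsRMatrix R) (h : H) :
    evalRight (Coalgebra.counit (R := k) (A := H)) (comulR R h) = h := by
  have h1 : ∀ (r : H ⊗[k] H) (a b : H), evalRight (Coalgebra.counit (R := k) (A := H))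
      (twist r (a ⊗ₜ[k] b)) = Coalgebra.counit (R := k) b •
        (a * antipode k (evalLeft (Coalgebra.counit (R := k) (A := H)) r)) := fun r a b => by
    induction r with
    | zero => simp
    | add x y hx hy => simp only [map_add, LinearMap.add_apply, hx, hy, mul_add, smul_add]
    | tmul s t => simp [twist_tmul, counit_ad, mul_smul, mul_comm]
  change evalRight _ (twist R (Coalgebra.comul h)) = h
  rw [comul_eq_sweedler, map_sweedler, map_sweedler]
  simp only [h1, evalLeft_counit_eq_one hR, antipode_one, mul_one]
  exact sweedler_counit_right LinearMap.id h

end Twist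

/-! ### The diagonal coaction on H ⊗ W -/

section InducedComodule

variable {k H : Type*} [Field k] [Ring H] [HopfAlgebra k H] {C : Type*} [AddCommGroup C]
  [Module k C] [Module H C] [IsScalarTower k H C] {Δ : C →ₗ[k] C ⊗[k] C} {ε : C →ₗ[k] k}
  {W : Type*} [AddCommGroup W] [Module k W]

theorem isBilin_map_lsmul_mk (x : C ⊗[k] W) : IsBilin k (fun u v : H =>
    TensorProduct.map (Algebra.lsmul k k C u) (TensorProduct.mk k H W v) x) :=
  ⟨by simp [TensorProduct.map_add_left], by simp [TensorProduct.map_smul_left],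
    by simp [TensorProduct.map_add_right], by simp [TensorProduct.map_smul_right]⟩

/-- The diagonal coaction `h ⊗ w ↦ ∑ h₍₁₎ w⟨-1⟩ ⊗ (h₍₂₎ ⊗ w⟨0⟩)`. -/
def IsInducedCoact (ρ : W →ₗ[k] C ⊗[k] W) (τ : H ⊗[k] W →ₗ[k] C ⊗[k] (H ⊗[k] W)) : Prop :=
  ∀ (h : H) (w : W), τ (h ⊗ₜ w) = sweedler k
    (fun u v => TensorProduct.map (Algebra.lsmul k k C u) (TensorProduct.mk k H W v) (ρ w)) h

/-- The comodule `H ⊗ W` with the diagonal coaction. -/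
def LeftComodule.induced (hΔ : IsEquivariant (H := H) Δ)
    (hε : ∀ (h : H) (c : C), ε (h • c) = Coalgebra.counit (R := k) h * ε c)
    (ρ : LeftComodule Δ ε W) (τ : H ⊗[k] W →ₗ[k] C ⊗[k] (H ⊗[k] W))
    (hτ : IsInducedCoact ρ.coact τ) : LeftComodule Δ ε (H ⊗[k] W) where
  coact := τ
  coassoc := by
    let K (a b v : H) : C ⊗[k] (C ⊗[k] W) →ₗ[k] C ⊗[k] (C ⊗[k] (H ⊗[k] W)) :=
      TensorProduct.map (Algebra.lsmul k k C a)
        (TensorProduct.map (Algebra.lsmul k k C b) (TensorProduct.mk k H W v))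
    have hK (x : C ⊗[k] (C ⊗[k] W)) : IsTrilin k (fun a b v : H => K a b v x) :=
      ⟨fun z => ⟨by simp [K, TensorProduct.map_add_left], by simp [K, TensorProduct.map_smul_left],
        by simp [K, TensorProduct.map_add_left, TensorProduct.map_add_right],
        by simp [K, TensorProduct.map_smul_left, TensorProduct.map_smul_right]⟩,
      fun z => ⟨by simp [K, TensorProduct.map_add_left, TensorProduct.map_add_right],
        by simp [K, TensorProduct.map_smul_left, TensorProduct.map_smul_right],
        by simp [K, TensorProduct.map_add_right], by simp [K, TensorProduct.map_smul_right]⟩⟩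
    -- Equivariance of Δ splits u over the two copies of C in `hl`, while `hr` splits v. The two
    -- results differ by coassociativity in H and in W.
    have hl (u v : H) (x : C ⊗[k] W) : TensorProduct.assoc k C C (H ⊗[k] W) (Δ.rTensor _
        (TensorProduct.map (Algebra.lsmul k k C u) (TensorProduct.mk k H W v) x)) =
        sweedler k (fun a b => K a b v (TensorProduct.assoc k C C W (Δ.rTensor W x))) u := by
      induction x with
      | zero => simp [sweedler]
      | add a b ha hb => simp only [map_add, ha, hb, sweedler_fun_add]
      | tmul c w =>
        rw [TensorProduct.map_tmul, LinearMap.rTensor_tmul]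
        change TensorProduct.assoc k C C (H ⊗[k] W) (Δ (u • c) ⊗ₜ (v ⊗ₜ w)) = _
        rw [hΔ]
        have := map_sweedler (k := k) ((TensorProduct.assoc k C C (H ⊗[k] W)).toLinearMap ∘ₗ
          (TensorProduct.mk k (C ⊗[k] C) (H ⊗[k] W)).flip (v ⊗ₜ w))
          (fun a b => TensorProduct.map (Algebra.lsmul k k C a)
            (Algebra.lsmul k k C b) (Δ c)) u
        refine this.trans (sweedler_congr (k := k) (fun a b => ?_) u)
        rw [LinearMap.rTensor_tmul]
        generalize Δ c = y
        induction y with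
        | zero => simp
        | add p q hp hq => simp only [map_add, TensorProduct.add_tmul, hp, hq]
        | tmul p q => simp [K]
    have hr (u v : H) (x : C ⊗[k] W) : τ.lTensor C
        (TensorProduct.map (Algebra.lsmul k k C u) (TensorProduct.mk k H W v) x) =
        sweedler k (fun b d => K u b d (ρ.coact.lTensor C x)) v := by
      induction x with
      | zero => simp [sweedler]
      | add a b ha hb => simp only [map_add, ha, hb, sweedler_fun_add]
      | tmul c w =>
        rw [TensorProduct.map_tmul, LinearMap.lTensor_tmul, TensorProduct.mk_apply, hτ,
          ← TensorProduct.mk_apply, map_sweedler]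
        rfl
    refine TensorProduct.ext' fun h w => ?_
    simp only [LinearMap.comp_apply, LinearEquiv.coe_coe]
    rw [hτ]
    have h1 := map_sweedler (k := k) ((TensorProduct.assoc k C C (H ⊗[k] W)).toLinearMap ∘ₗ
      Δ.rTensor (H ⊗[k] W)) (fun u v => TensorProduct.map (Algebra.lsmul k k C u)
        (TensorProduct.mk k H W v) (ρ.coact w)) h
    have h2 := map_sweedler (k := k) (τ.lTensor C) (fun u v => TensorProduct.map
      (Algebra.lsmul k k C u) (TensorProduct.mk k H W v) (ρ.coact w)) h
    refine h1.trans (Eq.trans ?_ h2.symm)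
    simp only [LinearMap.comp_apply, LinearEquiv.coe_coe, hl, hr]
    have h3 := LinearMap.congr_fun ρ.coassoc w
    simp only [LinearMap.comp_apply, LinearEquiv.coe_coe] at h3
    rw [h3]
    exact sweedler_coassoc (hK _) h
  counit := by
    have h1 (u v : H) (x : C ⊗[k] W) : evalLeft ε
        (TensorProduct.map (Algebra.lsmul k k C u) (TensorProduct.mk k H W v) x) =
        Coalgebra.counit (R := k) u • v ⊗ₜ[k] evalLeft ε x := by
      induction x with
      | zero => simp
      | add a b ha hb => simp only [map_add, ha, hb, TensorProduct.tmul_add, smul_add]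
      | tmul c w => simp [hε, mul_smul]
    refine TensorProduct.ext' fun h w => ?_
    change evalLeft ε (τ (h ⊗ₜ w)) = h ⊗ₜ w
    rw [hτ, map_sweedler]
    simp only [h1]
    have h2 : evalLeft ε (ρ.coact w) = w := LinearMap.congr_fun ρ.counit w
    rw [h2]
    exact sweedler_counit_left ((TensorProduct.mk k H W).flip w) h

theorem IsInducedCoact.isEquivariant {ρ : W →ₗ[k] C ⊗[k] W}
    {τ : H ⊗[k] W →ₗ[k] C ⊗[k] (H ⊗[k] W)} (hτ : IsInducedCoact ρ τ) :
    IsEquivariant (H := H) τ := fun g t => by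
  induction t with
  | zero => simp [sweedler]
  | add a b ha hb => simp only [smul_add, map_add, ha, hb, sweedler_fun_add]
  | tmul h w =>
    rw [TensorProduct.smul_tmul', smul_eq_mul, hτ, hτ, sweedler_mul (isBilin_map_lsmul_mk _)]
    refine sweedler_congr (k := k) (fun x y => ?_) g
    rw [map_sweedler]
    refine sweedler_congr (k := k) (fun u v => ?_) h
    generalize ρ w = z
    induction z with
    | zero => simp
    | add p q hp hq => simp only [map_add, hp, hq]
    | tmul p q => simp [TensorProduct.smul_tmul']

end InducedComodule

/-! ### Application to minimal adjoint-stable subcoalgebras -/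

namespace AdStableSubcoalgebra

variable {k : Type*} [Field k] {H : Type*} [Ring H] [HopfAlgebra k H] {R : H ⊗[k] H}
  (D : AdStableSubcoalgebra R)

/-- The adjoint action makes `D` an `H`-module. -/
instance : Module H D.carrier where
  smul h d := D.adAction h d
  one_smul _ := Subtype.ext (ad_one _)
  mul_smul g h _ := Subtype.ext (ad_mul g h _)
  smul_zero _ := map_zero _
  smul_add _ := map_add _
  add_smul g h d := LinearMap.congr_fun (map_add D.adAction g h) d
  zero_smul d := LinearMap.congr_fun (map_zero D.adAction) d

theorem smul_def (h : H) (d : D.carrier) : h • d = D.adAction h d := rfl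

theorem coe_smul (h : H) (d : D.carrier) : (↑(h • d) : H) = ad k H h d := rfl

instance : IsScalarTower k H D.carrier :=
  ⟨fun c h d => LinearMap.congr_fun (map_smul D.adAction c h) d⟩

theorem map_subtype_comul (d : D.carrier) :
    TensorProduct.map D.carrier.subtype D.carrier.subtype (D.comul d) = comulR R d :=
  map_subtype_restrictComul _ _ _ d

theorem isEquivariant_comul (hR : IsRMatrix R) : IsEquivariant (H := H) D.comul := fun h d => by
  apply map_subtype_injective D.carrier
  rw [map_subtype_comul, coe_smul, comulR_ad hR, map_sweedler]
  refine sweedler_congr (k := k) (fun u w => ?_) h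
  rw [← map_subtype_comul]
  generalize D.comul d = x
  induction x with
  | zero => simp
  | add a b ha hb => simp only [map_add, ha, hb]
  | tmul a b => simp [coe_smul]

theorem evalRight_counit_comul (hR : IsRMatrix R) (d : D.carrier) :
    evalRight D.counit (D.comul d) = d := by
  have h1 : ∀ x : D.carrier ⊗[k] D.carrier, ((evalRight D.counit x : D.carrier) : H) = evalRight
      (Coalgebra.counit (R := k) (A := H))
      (TensorProduct.map D.carrier.subtype D.carrier.subtype x) := fun x => by
    induction x with
    | zero => simp
    | add a b ha hb => simp only [map_add, Submodule.coe_add, ha, hb]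
    | tmul a b => simp [counit]
  refine Subtype.ext ?_
  rw [h1, map_subtype_comul, evalRight_counit_comulR hR]

theorem counit_smul (h : H) (d : D.carrier) :
    D.counit (h • d) = Coalgebra.counit (R := k) h * D.counit d :=
  counit_ad h d

-- A stable subcoalgebra of D is pushed forward to H, where it is a stable subcoalgebra of H_R
-- contained in D, so minimality of D applies.
variable {D} in
theorem IsMinimal.eq_top (hD : D.IsMinimal) (E : Submodule k D.carrier) (hE : E ≠ ⊥)
    (hΔ : IsSubcoalgebra D.comul E) (hs : ∀ h : H, ∀ c ∈ E, h • c ∈ E) : E = ⊤ := by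
  let E' : AdStableSubcoalgebra R :=
    { carrier := E.map D.carrier.subtype
      isSubcoalgebra := by
        rintro _ ⟨e, he, rfl⟩
        obtain ⟨y, hy⟩ := hΔ e he
        let i : E →ₗ[k] E.map D.carrier.subtype := D.carrier.subtype.submoduleMap E
        refine ⟨TensorProduct.map i i y, ?_⟩
        rw [Submodule.subtype_apply, ← map_subtype_comul, ← hy]
        rw [← LinearMap.comp_apply, ← LinearMap.comp_apply, ← TensorProduct.map_comp,
          ← TensorProduct.map_comp]
        rfl
      ad_mem := by
        rintro h _ ⟨e, he, rfl⟩
        exact ⟨h • e, hs h e he, rfl⟩ }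
  have hE' : E'.carrier ≠ ⊥ := fun h =>
    hE (by
    have h : E.map D.carrier.subtype = ⊥ := h
    exact Submodule.map_injective_of_injective D.carrier.injective_subtype (by simpa using h))
  have := hD.2 E' hE' (Submodule.map_subtype_le _ _)
  rw [eq_top_iff]
  intro d _
  have hd : (d : H) ∈ E'.carrier := by rw [this]; exact d.2
  obtain ⟨e, he, hed⟩ := hd
  rwa [← Subtype.ext hed]

variable {D} in
theorem ModuleComodule.isEquivariant {V : Type*} [AddCommGroup V] [Module k V] [Module H V]
    [IsScalarTower k H V] (σ : D.ModuleComodule V) : IsEquivariant (H := H) σ.coact := fun h v => by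
  rw [σ.coact_smul, comul_eq_sweedler]
  have := map_sweedler (k := k) (TensorProduct.map (TensorProduct.lift D.adAction)
      (TensorProduct.lift (Algebra.lsmul k k V).toLinearMap) ∘ₗ
    (TensorProduct.tensorTensorTensorComm k H H D.carrier V).toLinearMap ∘ₗ
      (TensorProduct.mk k (H ⊗[k] H) (D.carrier ⊗[k] V)).flip (σ.coact v))
    (fun x y => x ⊗ₜ[k] y) h
  refine this.trans (sweedler_congr (k := k) (fun u w => ?_) h)
  generalize σ.coact v = x
  induction x with
  | zero => simp
  | add a b ha hb =>
    rw [map_add, map_add, LinearMap.comp_add, LinearMap.comp_add, LinearMap.add_apply, ha, hb]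
  | tmul a b => simp [smul_def]

theorem isInducedCoact_inducedCoact {W : Type*} [AddCommGroup W] [Module k W]
    (ρ : D.Comodule W) : IsInducedCoact ρ.coact (D.inducedCoact ρ) := fun h w => by
  have := map_sweedler (k := k) ((TensorProduct.lift D.adAction).rTensor (H ⊗[k] W) ∘ₗ
    (TensorProduct.tensorTensorTensorComm k H H D.carrier W).toLinearMap ∘ₗ
      (TensorProduct.mk k (H ⊗[k] H) (D.carrier ⊗[k] W)).flip (ρ.coact w))
    (fun x y => x ⊗ₜ[k] y) h
  rw [← comul_eq_sweedler] at this
  refine Eq.trans this (sweedler_congr (k := k) (fun u v => ?_) h)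
  generalize ρ.coact w = x
  induction x with
  | zero => simp
  | add a b ha hb =>
    rw [map_add, map_add, LinearMap.comp_add, LinearMap.comp_add, LinearMap.add_apply, ha, hb]
  | tmul a b => simp [smul_def]

theorem finrank_dualCotensor_mul_finrank [FiniteDimensional k H] (hR : IsRMatrix R)
    (hD : D.IsMinimal) {W : Type*} [AddCommGroup W] [Module k W] [FiniteDimensional k W]
    (ρ : D.Comodule W) {V : Type*} [AddCommGroup V] [Module k V] [Module H V] [IsScalarTower k H V]
    [FiniteDimensional k V] (σ : D.Comodule V) (hσ : IsEquivariant (H := H) σ.coact) :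
    finrank k (D.dualCotensor ρ σ.coact) * finrank k D.carrier = finrank k V * finrank k W :=
  finrank_cotensor_mul_finrank (D.isEquivariant_comul hR) (D.evalRight_counit_comul hR)
    hD.eq_top ρ σ hσ

end AdStableSubcoalgebra

end Transmutation

theorem mainTheorem7 {k : Type*} [Field k] {H : Type*} [Ring H] [HopfAlgebra k H]
    [FiniteDimensional k H] [IsSemisimpleRing H]
    (hcos : Transmutation.IsCosemisimple (Coalgebra.comul (R := k) (A := H)))
    (R : H ⊗[k] H) (hR : Transmutation.IsRMatrix R)
    (D : Transmutation.AdStableSubcoalgebra R) (hD : D.IsMinimal) :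
    (∀ (W : Type*) [AddCommGroup W] [Module k W] [FiniteDimensional k W] [Nontrivial W]
        (ρ : D.Comodule W)
        (V : Type*) [AddCommGroup V] [Module k V] [Module H V] [IsScalarTower k H V]
        [FiniteDimensional k V] (σ : D.ModuleComodule V),
        Module.finrank k (D.dualCotensor ρ σ.coact) * Module.finrank k D.carrier =
          Module.finrank k V * Module.finrank k W) ∧
    (∀ (W : Type*) [AddCommGroup W] [Module k W] [FiniteDimensional k W] (ρ : D.Comodule W)
        (W' : Type*) [AddCommGroup W'] [Module k W'] [FiniteDimensional k W']
        (ρ' : D.Comodule W'),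
        Module.finrank k (D.N ρ ρ') * Module.finrank k D.carrier =
          Module.finrank k H * Module.finrank k W * Module.finrank k W') := by
  refine ⟨fun W _ _ _ _ ρ V _ _ _ _ _ σ =>
    D.finrank_dualCotensor_mul_finrank hR hD ρ σ.toLeftComodule σ.isEquivariant,
    fun W _ _ _ ρ W' _ _ _ ρ' => ?_⟩
  -- The second formula is the general one for V = H ⊗ W', whose coaction is an equivariant comodule
  -- structure.
  have hτ := D.isInducedCoact_inducedCoact ρ'
  have := D.finrank_dualCotensor_mul_finrank hR hD ρ
    (ρ'.induced (D.isEquivariant_comul hR) D.counit_smul _ hτ) hτ.isEquivariant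
  rw [Module.finrank_tensorProduct, mul_right_comm] at this
  exact this
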